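/- Let $K\ge 1$ and $\mathcal K_1=\{2,\dots,K\}$. A deterministic many-to-one interference channel has finite alphabets $\mathcal X_i,\mathcal Y_i$ ($1\le i\le K$) and $\mathcal V$. Its outputs are $Y_i=f_i(X_i)$ for $i\in\mathcal K_1$ and $Y_1=f_1(X_1,V)$, where the interference $V=v(X_2,\dots,X_K)\in\mathcal V$ is a function of the inputs of users $2,\dots,K$ and can be recovered from $(Y_1,X_1)$, i.e. $V=f_1^{-1}(Y_1,X_1)$ for some function $f_1^{-1}$. A code of length $T\ge 1$ consists of finite non-empty message sets $\mathcal W_i$, encoders $\phi_i:\mathcal W_i\to\mathcal X_i^T$ and decoders $\psi_i:\mathcal Y_i^T\to\mathcal W_i$ for $1\le i\le K$; its rate is $(R_1,\dots,R_K)$ with $R_i=\frac1T\log_2|\mathcal W_i|$, and its average probability of error is $\Pr(\exists i:\psi_i(Y_i^T)\ne W_i)$ for independent messages $W_i$ uniform on $\mathcal W_i$. A rate tuple is achievable if some sequence of codes, all of that rate and with lengths tending to infinity, has average probability of error tending to $0$; the capacity region $\mathcal C$ is the closure of the set of achievable rate tuples. Let $U_i=g_i(X_i)$, $i\in\mathcal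 K_1$, be finite-valued deterministic functions of the inputs such that $V$ is a deterministic function of $(U_2,\dots,U_K)$. For a product input distribution $p=\prod_{i=1}^K p_{X_i}$ let $\mathcal R(p)$ be the set of all $(R_1,\dots,R_K)$ with $R_i\ge 0$ for all $i$ and $$R_1\le H(Y_1|V),\qquad R_i\le H(Y_i)\quad(i\in\mathcal K_1),$$ $$R_1+\sum_{i\in\mathcal S}R_i\le H(Y_1|U_{\mathcal S^c})+\sum_{i\in\mathcal S}H(Y_i|U_i)\quad\text{for all }\mathcal S\subseteq\mathcal K_1,$$ where $\mathcal S^c=\mathcal K_1\setminus\mathcal S$, $U_{\mathcal S^c}=(U_i)_{i\in\mathcal S^c}$, and entropies are in bits and taken under $p$. Then the convex hull of $\bigcup_p\mathcal R(p)$, over all product input distributions $p$, is achievable, that is, it is contained in the capacity region $\mathcal C$. -/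

import Mathlib

namespace ManyToOne

/-! ### Entropies of random variables on a finite probability space, in bits -/

section Entropy

variable {Ω α β : Type*} [Fintype Ω]

open Classical in
/-- `law q A a` is the probability that `A = a`, when `ω : Ω` has probability `q ω`. -/
noncomputable def law (q : Ω → ℝ) (A : Ω → α) (a : α) : ℝ :=
  ∑ ω with A ω = a, q ω

/-- Shannon entropy `H(A)` in bits. -/
noncomputable def entropy [Fintype α] (q : Ω → ℝ) (A : Ω → α) : ℝ :=
  -∑ a, law q A a * Real.logb 2 (law q A a)

/-- Conditional Shannon entropy `H(A|B)` in bits. -/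
noncomputable def condEntropy [Fintype α] [Fintype β] (q : Ω → ℝ) (A : Ω → α) (B : Ω → β) : ℝ :=
  -∑ b, ∑ a, law q (fun ω => (A ω, B ω)) (a, b) *
    Real.logb 2 (law q (fun ω => (A ω, B ω)) (a, b) / law q B b)

end Entropy

/-- The deterministic many-to-one interference channel with `n + 1` users. User `1` is the index
`0`; the interfering users `2, …, K` are the indices `i.succ` with `i : Fin n`. -/
structure Channel {n : ℕ} (X Y : Fin (n + 1) → Type*) (V : Type*) where
  /-- `Y_i` as a function of `X_i`, for the users other than the first. -/
  out : ∀ i : Fin n, X i.succ → Y i.succ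
  /-- The interference `V` as a function of the inputs other than the first. -/
  interf : (∀ i : Fin n, X i.succ) → V
  /-- `Y_1 = f₁ (X_1, V)`. -/
  f₁ : X 0 → V → Y 0
  /-- `V` can be recovered from `(Y_1, X_1)`. -/
  invertible : ∃ finv : Y 0 → X 0 → V, ∀ x₁ x, finv (f₁ x₁ (interf x)) x₁ = interf x

section Coding

variable {n : ℕ} {X Y : Fin (n + 1) → Type*} {V : Type*}

/-- The value of `V` when the inputs are `x`. -/
def Channel.v (C : Channel X Y V) (x : ∀ i, X i) : V :=
  C.interf fun i => x i.succ

/-- The outputs `(Y_1, …, Y_K)` when the inputs are `x`. -/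
def Channel.y (C : Channel X Y V) (x : ∀ i, X i) : ∀ i, Y i :=
  Fin.cons (C.f₁ (x 0) (C.v x)) fun i => C.out i (x i.succ)

/-- A code: block length `T ≥ 1`, message sets `{0, …, M i - 1}`, encoders and decoders. -/
structure Code {n : ℕ} (X Y : Fin (n + 1) → Type*) where
  T : ℕ
  T_pos : 0 < T
  M : Fin (n + 1) → ℕ
  M_pos : ∀ i, 0 < M i
  enc : ∀ i, Fin (M i) → Fin T → X i
  dec : ∀ i, (Fin T → Y i) → Fin (M i)

/-- The rate tuple of a code, in bits per channel use. -/
noncomputable def Code.rate (c : Code X Y) (i : Fin (n + 1)) : ℝ :=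
  Real.logb 2 (c.M i) / c.T

/-- The decision of receiver `i` when the messages `w` are sent over `T` uses of the channel. -/
def Code.decoded (c : Code X Y) (C : Channel X Y V) (w : ∀ i, Fin (c.M i)) (i : Fin (n + 1)) :
    Fin (c.M i) :=
  c.dec i fun t => C.y (fun j => c.enc j (w j) t) i

open Classical in
/-- The average probability of error: the messages are independent and uniform, and an error
occurs when some receiver does not recover its message. -/
noncomputable def Code.errorProb (c : Code X Y) (C : Channel X Y V) : ℝ :=
  (Finset.univ.filter fun w : ∀ i, Fin (c.M i) => ∃ i, c.decoded C w i ≠ w i).card /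
    ∏ i, (c.M i : ℝ)

/-- `R` is achievable: some sequence of codes with growing block lengths, all of rate `R`, has
vanishing average probability of error. -/
def Channel.Achievable (C : Channel X Y V) (R : Fin (n + 1) → ℝ) : Prop :=
  ∃ c : ℕ → Code X Y, (∀ m, (c m).rate = R) ∧
    Filter.Tendsto (fun m => (c m).T) Filter.atTop Filter.atTop ∧
    Filter.Tendsto (fun m => (c m).errorProb C) Filter.atTop (nhds 0)

/-- The capacity region: the closure of the set of achievable rate tuples. -/
def Channel.capacityRegion (C : Channel X Y V) : Set (Fin (n + 1) → ℝ) :=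
  closure {R | C.Achievable R}

/-- The joint law of independent inputs `X_i` with laws `p i`. -/
def prodLaw (p : ∀ i, X i → ℝ) (x : ∀ i, X i) : ℝ :=
  ∏ i, p i (x i)

/-- The auxiliary variables `U_i = g_i (X_i)`, `i ∉ S`, for a set `S` of interfering users. -/
def auxCompl {U : Fin n → Type*} (g : ∀ i : Fin n, X i.succ → U i) (S : Finset (Fin n))
    (x : ∀ i, X i) (i : {i : Fin n // i ∉ S}) : U i :=
  g i (x i.1.succ)

open Classical in
/-- The rate region for auxiliaries `U_i = g_i (X_i)` and independent inputs with laws `p i`. -/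
noncomputable def Channel.rateRegion [∀ i, Fintype (X i)] [∀ i, Fintype (Y i)] [Fintype V]
    (C : Channel X Y V) {U : Fin n → Type*} [∀ i, Fintype (U i)]
    (g : ∀ i : Fin n, X i.succ → U i) (p : ∀ i, X i → ℝ) : Set (Fin (n + 1) → ℝ) :=
  {R | (∀ i, 0 ≤ R i) ∧
    R 0 ≤ condEntropy (prodLaw p) (fun x => C.y x 0) C.v ∧
    (∀ i : Fin n, R i.succ ≤ entropy (prodLaw p) (fun x => C.y x i.succ)) ∧
    ∀ S : Finset (Fin n), R 0 + ∑ i ∈ S, R i.succ ≤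
      condEntropy (prodLaw p) (fun x => C.y x 0) (auxCompl g S) +
        ∑ i ∈ S, condEntropy (prodLaw p) (fun x => C.y x i.succ) (fun x => g i (x i.succ))}

end Coding

end ManyToOne

/-!
The rates are achieved by superposition coding. Each user draws random cloud centers with the law
of its auxiliary `U_i` (for user `1`, of `X_1` itself) and, around each of them, satellite
codewords with the conditional law of `X_i` given `U_i`. Since `V` is a function of the auxiliaries
of the interfering users, `Y_1` is a function of the cloud centers of all users. Receiver `1` looks
for any cloud centers that explain its output, and the wrong ones of the other users do not matter.

The channel is deterministic, so an error means that a wrong codeword produces the same output as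
the right one. If exactly the clouds of the users in `D` are wrong, each candidate does so with the
conditional probability of `Y_1` given `U_i`, `i ∉ D`, and `k` candidates collide with probability
at most `𝔼 [min 1 (k * P (Y_1 | U_Dᶜ))]`. As `min 1 z ≤ z ^ ρ`, in `T` uses of the channel this is
at most the `T`-th power of a function of `ρ ∈ [0, 1]` that is `1` at `ρ = 0` and has a negative
derivative there as soon as the rate of the clouds in `D` is below `H(Y_1|U_Dᶜ)`.

The satellites of user `i` carry the rate `min R_i H(Y_i|U_i)` and its clouds carry the rest, so
only the users with `R_i > H(Y_i|U_i)` burden receiver `1`; the inequality of the rate region for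
these users bounds their cloud rates. Convex combinations of input laws are obtained by letting the
law of the random code vary over the block in proportion to the weights.
-/

namespace ManyToOne

open Finset

/-! ### Finite weighted probability -/

section Weights

variable {Ω α β γ δ : Type*} [Fintype Ω]

open Classical in
/-- The total weight of the event `E`. -/
noncomputable def prob (q : Ω → ℝ) (E : Ω → Prop) : ℝ :=
  ∑ ω with E ω, q ω

theorem law_eq_prob (q : Ω → ℝ) (A : Ω → α) (a : α) : law q A a = prob q (fun ω => A ω = a) := rfl

theorem prob_eq_sum_ite (q : Ω → ℝ) (E : Ω → Prop) [DecidablePred E] :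
    prob q E = ∑ ω, if E ω then q ω else 0 := by
  rw [prob, sum_filter]
  congr!

theorem prob_nonneg {q : Ω → ℝ} (hq : ∀ ω, 0 ≤ q ω) (E : Ω → Prop) : 0 ≤ prob q E :=
  sum_nonneg fun ω _ => hq ω

theorem prob_mono {q : Ω → ℝ} (hq : ∀ ω, 0 ≤ q ω) {E F : Ω → Prop}
    (h : ∀ ω, q ω ≠ 0 → E ω → F ω) : prob q E ≤ prob q F := by
  classical
  simp only [prob_eq_sum_ite]
  refine sum_le_sum fun ω _ => ?_
  have := hq ω
  have := h ω
  grind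

theorem prob_congr {q : Ω → ℝ} {E F : Ω → Prop} (h : ∀ ω, q ω ≠ 0 → (E ω ↔ F ω)) :
    prob q E = prob q F := by
  classical
  simp only [prob_eq_sum_ite]
  refine sum_congr rfl fun ω _ => ?_
  have := h ω
  grind

theorem prob_or_le {q : Ω → ℝ} (hq : ∀ ω, 0 ≤ q ω) (E F : Ω → Prop) :
    prob q (fun ω => E ω ∨ F ω) ≤ prob q E + prob q F := by
  classical
  simp only [prob_eq_sum_ite, ← sum_add_distrib]
  refine sum_le_sum fun ω _ => ?_
  have := hq ω
  grind

theorem prob_exists_le {J : Type*} {q : Ω → ℝ} (hq : ∀ ω, 0 ≤ q ω) (s : Finset J)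
    (E : J → Ω → Prop) :
    prob q (fun ω => ∃ j ∈ s, E j ω) ≤ ∑ j ∈ s, prob q (E j) := by
  classical
  induction s using Finset.induction with
  | empty => simp [prob]
  | insert j s hj ih =>
    simp only [exists_mem_insert, sum_insert hj]
    exact (prob_or_le hq _ _).trans (by gcongr)

theorem sum_prob_and [Fintype α] (q : Ω → ℝ) (A : Ω → α) (E : Ω → Prop) :
    ∑ a, prob q (fun ω => A ω = a ∧ E ω) = prob q E := by
  classical
  simp only [prob, and_comm, ← filter_filter]
  exact sum_fiberwise _ _ _

theorem sum_law_mul [Fintype α] (q : Ω → ℝ) (A : Ω → α) (ψ : α → ℝ) :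
    ∑ a, law q A a * ψ a = ∑ ω, q ω * ψ (A ω) := by
  classical
  simp only [law_eq_prob, prob_eq_sum_ite, sum_mul]
  rw [sum_comm]
  simp [ite_mul]

theorem sum_law [Fintype α] (q : Ω → ℝ) (A : Ω → α) : ∑ a, law q A a = ∑ ω, q ω := by
  simpa using sum_law_mul q A fun _ => 1

theorem prob_law [Fintype α] (q : Ω → ℝ) (A : Ω → α) (E : α → Prop) :
    prob (law q A) E = prob q (fun ω => E (A ω)) := by
  classical
  simpa [prob_eq_sum_ite] using sum_law_mul q A fun a => if E a then 1 else 0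

theorem law_law [Fintype α] (q : Ω → ℝ) (A : Ω → α) (r : α → β) :
    law (law q A) r = law q (fun ω => r (A ω)) :=
  funext fun b => prob_law q A fun a => r a = b

theorem law_equiv (q : Ω → ℝ) (e : Ω ≃ α) (a : α) : law q e a = q (e.symm a) := by
  classical
  simp [law_eq_prob, prob_eq_sum_ite, ← Equiv.eq_symm_apply]

theorem law_id (q : Ω → ℝ) : law q (fun ω => ω) = q :=
  funext (law_equiv q (Equiv.refl Ω))

theorem law_nonneg {q : Ω → ℝ} (hq : ∀ ω, 0 ≤ q ω) (A : Ω → α) (a : α) : 0 ≤ law q A a :=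
  prob_nonneg hq _

theorem le_law {q : Ω → ℝ} (hq : ∀ ω, 0 ≤ q ω) (A : Ω → α) (ω : Ω) : q ω ≤ law q A (A ω) :=
  single_le_sum (f := q) (fun ω _ => hq ω) (by simp)

theorem law_pos {q : Ω → ℝ} (hq : ∀ ω, 0 ≤ q ω) (A : Ω → α) {ω : Ω} (h : q ω ≠ 0) :
    0 < law q A (A ω) :=
  ((hq ω).lt_of_ne' h).trans_le (le_law hq A ω)

theorem law_prodMk_le_right {q : Ω → ℝ} (hq : ∀ ω, 0 ≤ q ω) (A : Ω → α) (B : Ω → β) (x : α × β) :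
    law q (fun ω => (A ω, B ω)) x ≤ law q B x.2 :=
  prob_mono hq fun _ _ h => congrArg Prod.snd h

theorem prob_and_eq_sum_law [Fintype α] (q : Ω → ℝ) (A : Ω → α) (B : Ω → β)
    (E : α → Prop) [DecidablePred E] (b : β) :
    prob q (fun ω => E (A ω) ∧ B ω = b) =
      ∑ a with E a, law q (fun ω => (A ω, B ω)) (a, b) := by
  rw [← sum_prob_and q A, sum_filter]
  refine sum_congr rfl fun a _ => ?_
  split_ifs with ha
  · exact prob_congr fun ω _ => by grind
  · classical
    rw [prob_eq_sum_ite]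
    exact sum_eq_zero fun ω _ => if_neg (by grind)

theorem sum_law_prodMk [Fintype α] (q : Ω → ℝ) (A : Ω → α) (B : Ω → β) (b : β) :
    ∑ a, law q (fun ω => (A ω, B ω)) (a, b) = law q B b := by
  simpa [law_eq_prob] using sum_prob_and q A fun ω => B ω = b

/-! ### Conditional probabilities and the union bound for collisions -/

/-- The conditional probability of the value of `A` at `ω` given the value of `B` at `ω`. -/
noncomputable def condProb (q : Ω → ℝ) (A : Ω → α) (B : Ω → β) (ω : Ω) : ℝ :=
  law q (fun ω => (A ω, B ω)) (A ω, B ω) / law q B (B ω)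

theorem condProb_nonneg {q : Ω → ℝ} (hq : ∀ ω, 0 ≤ q ω) (A : Ω → α) (B : Ω → β) (ω : Ω) :
    0 ≤ condProb q A B ω :=
  div_nonneg (law_nonneg hq _ _) (law_nonneg hq _ _)

theorem condProb_le_one {q : Ω → ℝ} (hq : ∀ ω, 0 ≤ q ω) (A : Ω → α) (B : Ω → β) (ω : Ω) :
    condProb q A B ω ≤ 1 :=
  div_le_one_of_le₀ (law_prodMk_le_right hq A B _) (law_nonneg hq _ _)

theorem condProb_pos {q : Ω → ℝ} (hq : ∀ ω, 0 ≤ q ω) (A : Ω → α) (B : Ω → β) {ω : Ω}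
    (h : q ω ≠ 0) : 0 < condProb q A B ω :=
  div_pos (law_pos hq (fun ω => (A ω, B ω)) h) (law_pos hq B h)

theorem condProb_law [Fintype γ] (q : Ω → ℝ) (φ : Ω → γ) (A : γ → α) (B : γ → β) (ω : Ω) :
    condProb (law q φ) A B (φ ω) = condProb q (fun ω => A (φ ω)) (fun ω => B (φ ω)) ω := by
  simp only [condProb, law_law]

theorem condProb_congr {q : Ω → ℝ} {A : Ω → α} {A' : Ω → γ} {B : Ω → β} {B' : Ω → δ} {ω : Ω}
    (hA : ∀ ω', q ω' ≠ 0 → (A ω' = A ω ↔ A' ω' = A' ω))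
    (hB : ∀ ω', q ω' ≠ 0 → (B ω' = B ω ↔ B' ω' = B' ω)) :
    condProb q A B ω = condProb q A' B' ω := by
  simp only [condProb, law_eq_prob, Prod.mk.injEq]
  congr 1
  · exact prob_congr fun ω' h => by rw [hA ω' h, hB ω' h]
  · exact prob_congr hB

/-- The union bound for the probability that one of `k` conditional copies of `A` given `B`
takes the value of `A`. -/
noncomputable def collisionBound (q : Ω → ℝ) (A : Ω → α) (B : Ω → β) (k : ℕ) : ℝ :=
  ∑ ω, q ω * min 1 (k * condProb q A B ω)

theorem collisionBound_law [Fintype γ] (q : Ω → ℝ) (φ : Ω → γ) (A : γ → α) (B : γ → β) (k : ℕ) :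
    collisionBound (law q φ) A B k =
      collisionBound q (fun ω => A (φ ω)) (fun ω => B (φ ω)) k := by
  simp only [collisionBound, sum_law_mul q φ, condProb_law]

theorem collisionBound_congr {q : Ω → ℝ} {A : Ω → α} {A' : Ω → γ} {B : Ω → β} {B' : Ω → δ}
    (hA : ∀ ω ω', q ω ≠ 0 → q ω' ≠ 0 → (A ω' = A ω ↔ A' ω' = A' ω))
    (hB : ∀ ω ω', q ω ≠ 0 → q ω' ≠ 0 → (B ω' = B ω ↔ B' ω' = B' ω)) (k : ℕ) :
    collisionBound q A B k = collisionBound q A' B' k := by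
  refine sum_congr rfl fun ω _ => ?_
  by_cases h : q ω = 0
  · simp [h]
  · rw [condProb_congr (fun ω' => hA ω ω' h) fun ω' => hB ω ω' h]

theorem collisionBound_nonneg {q : Ω → ℝ} (hq : ∀ ω, 0 ≤ q ω) (A : Ω → α) (B : Ω → β) (k : ℕ) :
    0 ≤ collisionBound q A B k :=
  sum_nonneg fun ω _ => mul_nonneg (hq ω) <|
    le_min zero_le_one (mul_nonneg k.cast_nonneg (condProb_nonneg hq A B ω))

end Weights

/-! ### Conditional entropy -/

section Entropy

variable {Ω α β γ : Type*} [Fintype Ω] {q : Ω → ℝ}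

theorem sum_mul_condProb_div_condProb_le [Finite α] [Finite β] (hq : ∀ ω, 0 ≤ q ω) (A : Ω → α)
    (B : Ω → β) (r : β → γ) :
    ∑ ω, q ω * (condProb q A (fun ω => r (B ω)) ω / condProb q A B ω) ≤ ∑ ω, q ω := by
  have := Fintype.ofFinite α
  have := Fintype.ofFinite β
  let l : α × β → ℝ := law q fun ω => (A ω, B ω)
  let l' : α × γ → ℝ := law q fun ω => (A ω, r (B ω))
  let m : β → ℝ := law q B
  let m' : γ → ℝ := law q fun ω => r (B ω)
  calc ∑ ω, q ω * (condProb q A (fun ω => r (B ω)) ω / condProb q A B ω)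
    _ = ∑ t : α × β, l t * ((l' (t.1, r t.2) / m' (r t.2)) / (l t / m t.2)) :=
        (sum_law_mul q (fun ω => (A ω, B ω))
          fun t => (l' (t.1, r t.2) / m' (r t.2)) / (l t / m t.2)).symm
    _ ≤ ∑ t : α × β, m t.2 * (l' (t.1, r t.2) / m' (r t.2)) := by
        refine sum_le_sum fun t _ => ?_
        by_cases hl : l t = 0
        · simpa [hl] using mul_nonneg (law_nonneg hq B t.2) <|
            div_nonneg (law_nonneg hq (fun ω => (A ω, r (B ω))) _) (law_nonneg hq _ (r t.2))
        · exact le_of_eq (by field_simp)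
    _ = ∑ b, m b * (m' (r b) / m' (r b)) := by
        simp only [Fintype.sum_prod_type_right, ← mul_sum, ← sum_div]
        exact sum_congr rfl fun b _ => by rw [sum_law_prodMk q A (fun ω => r (B ω))]
    _ ≤ ∑ b, m b := sum_le_sum fun b _ =>
        mul_le_of_le_one_right (law_nonneg hq B b) (div_self_le_one _)
    _ = ∑ ω, q ω := sum_law q B

variable [Fintype α] [Fintype β] [Fintype γ]

theorem condEntropy_eq_sum (q : Ω → ℝ) (A : Ω → α) (B : Ω → β) :
    condEntropy q A B = -∑ ω, q ω * Real.logb 2 (condProb q A B ω) := by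
  rw [condEntropy, sum_comm, ← Fintype.sum_prod_type']
  exact congrArg Neg.neg (sum_law_mul q (fun ω => (A ω, B ω))
    fun x => Real.logb 2 (law q (fun ω => (A ω, B ω)) x / law q B x.2))

theorem condEntropy_unit (hq : ∑ ω, q ω = 1) (A : Ω → α) :
    condEntropy q A (fun _ => ()) = entropy q A := by
  have h (ω : Ω) : condProb q A (fun _ => ()) ω = law q A (A ω) := by
    have hunit : law q (fun _ => ()) () = 1 := by simpa [law] using hq
    rw [condProb, hunit, div_one]
    exact prob_congr fun ω' _ => by simp
  simp only [condEntropy_eq_sum, h, entropy, sum_law_mul q A fun a => Real.logb 2 (law q A a)]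

theorem condEntropy_nonneg (hq : ∀ ω, 0 ≤ q ω) (A : Ω → α) (B : Ω → β) :
    0 ≤ condEntropy q A B := by
  rw [condEntropy_eq_sum]
  exact neg_nonneg.2 <| sum_nonpos fun ω _ => mul_nonpos_of_nonneg_of_nonpos (hq ω) <|
    Real.logb_nonpos one_lt_two (condProb_nonneg hq A B ω) (condProb_le_one hq A B ω)

theorem condEntropy_congr {A : Ω → α} {B : Ω → β} {B' : Ω → γ}
    (hB : ∀ ω ω', B ω = B ω' ↔ B' ω = B' ω') : condEntropy q A B = condEntropy q A B' := by
  simp only [condEntropy_eq_sum]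
  refine congrArg Neg.neg (sum_congr rfl fun ω _ => ?_)
  rw [condProb_congr (fun _ _ => Iff.rfl) fun ω' _ => hB ω' ω]

theorem condEntropy_le_comp (hq : ∀ ω, 0 ≤ q ω) (A : Ω → α) (B : Ω → β) (r : β → γ) :
    condEntropy q A B ≤ condEntropy q A fun ω => r (B ω) := by
  let c : Ω → ℝ := condProb q A B
  let c' : Ω → ℝ := condProb q A fun ω => r (B ω)
  have hlog : 0 < Real.log 2 := Real.log_pos one_lt_two
  have hle (ω : Ω) :
      q ω * Real.logb 2 (c' ω) - q ω * Real.logb 2 (c ω) ≤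
        (q ω * (c' ω / c ω) - q ω) / Real.log 2 := by
    by_cases h : q ω = 0
    · simp [h]
    have hc : 0 < c ω := condProb_pos hq A B h
    have hc' : 0 < c' ω := condProb_pos hq A (fun ω => r (B ω)) h
    rw [← mul_sub, ← Real.logb_div hc'.ne' hc.ne', ← mul_sub_one, mul_div_assoc]
    exact mul_le_mul_of_nonneg_left (div_le_div_of_nonneg_right
      (Real.log_le_sub_one_of_pos (div_pos hc' hc)) hlog.le) (hq ω)
  have hgibbs : ∑ ω, (q ω * Real.logb 2 (c' ω) - q ω * Real.logb 2 (c ω)) ≤ 0 := by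
    refine (sum_le_sum fun ω _ => hle ω).trans ?_
    rw [← sum_div, sum_sub_distrib]
    exact div_nonpos_of_nonpos_of_nonneg
      (sub_nonpos.2 (sum_mul_condProb_div_condProb_le hq A B r)) hlog.le
  rw [sum_sub_distrib, sub_nonpos] at hgibbs
  rw [condEntropy_eq_sum, condEntropy_eq_sum]
  exact neg_le_neg hgibbs

end Entropy

/-! ### Product weights -/

section Product

variable {K J : Type*} [Fintype K] {Z : K → Type*}

/-- The product of the weights `w k`; `prodLaw` for an arbitrary finite index type. -/
def piLaw (w : ∀ k, Z k → ℝ) (ω : ∀ k, Z k) : ℝ :=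
  ∏ k, w k (ω k)

theorem piLaw_nonneg {w : ∀ k, Z k → ℝ} (hw : ∀ k z, 0 ≤ w k z) (ω : ∀ k, Z k) :
    0 ≤ piLaw w ω :=
  prod_nonneg fun k _ => hw k _

theorem ne_zero_of_piLaw_ne_zero {w : ∀ k, Z k → ℝ} {ω : ∀ k, Z k} (h : piLaw w ω ≠ 0) (k : K) :
    w k (ω k) ≠ 0 :=
  prod_ne_zero_iff.1 h k (mem_univ k)

variable [DecidableEq K] [∀ k, Fintype (Z k)]

theorem sum_piLaw_mul_prod (w f : ∀ k, Z k → ℝ) :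
    ∑ ω, piLaw w ω * ∏ k, f k (ω k) = ∏ k, ∑ z, w k z * f k z := by
  simp only [piLaw, ← prod_mul_distrib]
  rw [prod_univ_sum, Fintype.piFinset_univ]

theorem sum_piLaw {w : ∀ k, Z k → ℝ} (hw : ∀ k, ∑ z, w k z = 1) : ∑ ω, piLaw w ω = 1 := by
  simpa [hw] using sum_piLaw_mul_prod w fun _ _ => 1

theorem prob_piLaw_forall (w : ∀ k, Z k → ℝ) (E : ∀ k, Z k → Prop) :
    prob (piLaw w) (fun ω => ∀ k, E k (ω k)) = ∏ k, prob (w k) (E k) := by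
  classical
  simpa only [prob_eq_sum_ite, mul_ite, mul_one, mul_zero, prod_ite_zero, prod_const_one,
    mem_univ, true_implies] using sum_piLaw_mul_prod w fun k z => if E k z then 1 else 0

theorem law_piLaw_comp [Fintype J] {W : J → Type*} {w : ∀ k, Z k → ℝ}
    (hw : ∀ k, ∑ z, w k z = 1) {e : J → K} (he : Function.Injective e)
    (r : ∀ j, Z (e j) → W j) :
    law (piLaw w) (fun ω j => r j (ω (e j))) = piLaw fun j => law (w (e j)) (r j) := by
  funext v
  have hE (ω : ∀ k, Z k) : (fun j => r j (ω (e j))) = v ↔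
      ∀ k j, ∀ h : e j = k, r j (h ▸ ω k) = v j := by
    rw [funext_iff]
    exact ⟨fun h k j hj => by subst hj; exact h j, fun h j => h _ j rfl⟩
  simp only [law_eq_prob, hE]
  rw [prob_piLaw_forall w fun k z => ∀ j, ∀ h : e j = k, r j (h ▸ z) = v j]
  refine (Fintype.prod_of_injective e he _ _ (fun k hk => ?_) fun j => ?_).symm
  · classical
    rw [← hw k, prob_eq_sum_ite]
    exact sum_congr rfl fun z _ => if_pos fun j hj => (hk ⟨j, hj⟩).elim
  · refine prob_congr fun z _ => ⟨fun h j' hj' => ?_, fun h => h j rfl⟩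
    obtain rfl := he hj'
    exact h

theorem law_piLaw_eval {γ : Type*} {w : ∀ k, Z k → ℝ} (hw : ∀ k, ∑ z, w k z = 1) (k : K)
    (r : Z k → γ) : law (piLaw w) (fun ω => r (ω k)) = law (w k) r := by
  funext c
  simpa [law_eq_prob, funext_iff, piLaw] using
    congrFun (law_piLaw_comp hw (e := fun _ : Unit => k) (fun _ _ _ => rfl) fun _ => r) fun _ => c

theorem condProb_piLaw {α β : K → Type*} (w : ∀ k, Z k → ℝ) (A : ∀ k, Z k → α k)
    (B : ∀ k, Z k → β k) (ω : ∀ k, Z k) :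
    condProb (piLaw w) (fun ω k => A k (ω k)) (fun ω k => B k (ω k)) ω =
      ∏ k, condProb (w k) (A k) (B k) (ω k) := by
  have hAB := prob_piLaw_forall w fun k z => A k z = A k (ω k) ∧ B k z = B k (ω k)
  have hB := prob_piLaw_forall w fun k z => B k z = B k (ω k)
  simp only [condProb, prod_div_distrib, law_eq_prob, Prod.mk.injEq, ← hAB, ← hB, funext_iff,
    forall_and]

end Product

/-! ### Collisions of conditionally independent copies -/

section Collision

variable {Ω α β Y J : Type*} [Fintype Ω]

/-- `A'` is a copy of `A` that is conditionally independent of `A` given `B`. The defining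
equation is multiplied out, so that it also makes sense where `B = b` has probability zero. -/
def IsCondCopy (q : Ω → ℝ) (A A' : Ω → α) (B : Ω → β) : Prop :=
  ∀ a a' b, law q (fun ω => (A' ω, A ω, B ω)) (a', a, b) * law q B b =
    law q (fun ω => (A ω, B ω)) (a, b) * law q (fun ω => (A ω, B ω)) (a', b)

variable {q : Ω → ℝ} {A A' : Ω → α} {B : Ω → β}

theorem IsCondCopy.of_law_eq_mul [Fintype α] {μ : β → ℝ} {ν : β → α → ℝ}
    (h : ∀ a a' b, law q (fun ω => (A' ω, A ω, B ω)) (a', a, b) = μ b * ν b a * ν b a')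
    (hν : ∀ b, μ b ≠ 0 → ∑ a, ν b a = 1) : IsCondCopy q A A' B := by
  have hAB (a : α) (b : β) : law q (fun ω => (A ω, B ω)) (a, b) = μ b * ν b a := by
    rw [← sum_law_prodMk q A']
    by_cases hb : μ b = 0
    · simp [h, hb]
    · simp only [h, ← mul_sum, hν b hb, mul_one]
  have hB (b : β) : law q B b = μ b := by
    rw [← sum_law_prodMk q A]
    by_cases hb : μ b = 0
    · simp [hAB, hb]
    · simp only [hAB, ← mul_sum, hν b hb, mul_one]
  intro a a' b
  rw [h, hAB, hAB, hB]
  ring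

theorem IsCondCopy.of_law {Ω' : Type*} [Fintype Ω'] {φ : Ω → Ω'} {A A' : Ω' → α} {B : Ω' → β}
    (h : IsCondCopy (law q φ) A A' B) :
    IsCondCopy q (fun ω => A (φ ω)) (fun ω => A' (φ ω)) fun ω => B (φ ω) := by
  simpa only [IsCondCopy, law_law] using h

theorem IsCondCopy.prob_collision [Fintype α] [Fintype β] (hq : ∀ ω, 0 ≤ q ω)
    (h : IsCondCopy q A A' B) (F : β → α → Y) (a : α) (b : β) :
    prob q (fun ω => F b (A' ω) = F b a ∧ (A ω, B ω) = (a, b)) =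
      law q (fun ω => (A ω, B ω)) (a, b) *
        condProb (law q fun ω => (A ω, B ω)) (fun x => F x.2 x.1) Prod.snd (a, b) := by
  classical
  simp only [condProb, law_law]
  obtain hb | hb := eq_or_ne (law q B b) 0
  · rw [hb, div_zero, mul_zero]
    refine le_antisymm ?_ (prob_nonneg hq _)
    exact hb ▸ prob_mono hq fun _ _ hω => congrArg Prod.snd hω.2
  have hF : law q (fun ω => (F (B ω) (A ω), B ω)) (F b a, b) =
      prob q fun ω => F b (A ω) = F b a ∧ B ω = b :=
    prob_congr fun ω _ => by grind
  rw [← mul_div_assoc, eq_div_iff hb, hF,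
    prob_and_eq_sum_law q A' (fun ω => (A ω, B ω)) (fun a' => F b a' = F b a),
    prob_and_eq_sum_law q A B (fun a' => F b a' = F b a), sum_mul, mul_sum]
  exact sum_congr rfl fun a' _ => h a a' b

theorem prob_exists_collision_le [Finite α] [Finite β] (hq : ∀ ω, 0 ≤ q ω) {A' : J → Ω → α}
    {s : Finset J} (h : ∀ j ∈ s, IsCondCopy q A (A' j) B) (F : β → α → Y) {k : ℕ} (hk : #s ≤ k) :
    prob q (fun ω => ∃ j ∈ s, F (B ω) (A' j ω) = F (B ω) (A ω)) ≤
      collisionBound q (fun ω => F (B ω) (A ω)) B k := by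
  have := Fintype.ofFinite α
  have := Fintype.ofFinite β
  set Q := law q fun ω => (A ω, B ω)
  have hQ : ∀ x, 0 ≤ Q x := law_nonneg hq _
  calc prob q (fun ω => ∃ j ∈ s, F (B ω) (A' j ω) = F (B ω) (A ω))
    _ = ∑ x : α × β, prob q (fun ω => (A ω, B ω) = x ∧ ∃ j ∈ s, F x.2 (A' j ω) = F x.2 x.1) := by
        rw [← sum_prob_and q fun ω => (A ω, B ω)]
        exact sum_congr rfl fun x _ => prob_congr fun ω _ => by grind
    _ ≤ collisionBound Q (fun x => F x.2 x.1) Prod.snd k := sum_le_sum fun x _ => ?_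
    _ = _ := collisionBound_law q (fun ω => (A ω, B ω)) _ _ k
  rw [mul_min_of_nonneg _ _ (hQ x), mul_one]
  refine le_min (prob_mono hq fun _ _ hω => hω.1) ?_
  calc prob q (fun ω => (A ω, B ω) = x ∧ ∃ j ∈ s, F x.2 (A' j ω) = F x.2 x.1)
    _ ≤ ∑ j ∈ s, prob q (fun ω => F x.2 (A' j ω) = F x.2 x.1 ∧ (A ω, B ω) = x) :=
        (prob_mono hq fun _ _ hω => hω.2.imp fun j hj => ⟨hj.1, hj.2, hω.1⟩).trans
          (prob_exists_le hq s _)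
    _ = #s * (Q x * condProb Q (fun x => F x.2 x.1) Prod.snd x) := by
        rw [← nsmul_eq_mul]
        exact sum_eq_card_nsmul fun j hj => (h j hj).prob_collision hq F x.1 x.2
    _ ≤ k * (Q x * condProb Q (fun x => F x.2 x.1) Prod.snd x) := by
        gcongr
        exact mul_nonneg (hQ x) (condProb_nonneg hQ _ _ _)
    _ = _ := by ring

end Collision

/-! ### Superposition codebooks -/

section Block

variable {X U N J : Type*}

theorem law_compProd {α β γ : Type*} [Fintype α] [Fintype β] (μ : β → ℝ) (ν : β → α → ℝ)
    (r : α → γ) (b : β) (c : γ) :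
    law (fun t : β × α => μ t.1 * ν t.1 t.2) (fun t => (t.1, r t.2)) (b, c) =
      μ b * law (ν b) r c := by
  classical
  simp only [law_eq_prob, prob_eq_sum_ite, Fintype.sum_prod_type, Prod.mk.injEq, ite_and, mul_sum]
  simp

variable [Fintype X]

open Classical in
/-- The conditional law of `x` given `g x = u`. -/
noncomputable def fiberLaw (P : X → ℝ) (g : X → U) (u : U) (x : X) : ℝ :=
  if g x = u then P x / law P g u else 0

/-- The law of a cloud center `u`, distributed as `g x`, together with satellites that are
independent given `u` and have the conditional law of `x` given `g x = u`. -/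
noncomputable def blockLaw [Fintype N] (P : X → ℝ) (g : X → U) (b : U × (N → X)) : ℝ :=
  law P g b.1 * piLaw (fun _ => fiberLaw P g b.1) b.2

variable {P : X → ℝ} {g : X → U}

theorem fiberLaw_nonneg (hP : ∀ x, 0 ≤ P x) (u : U) (x : X) : 0 ≤ fiberLaw P g u x := by
  rw [fiberLaw]
  split_ifs
  exacts [div_nonneg (hP x) (law_nonneg hP _ _), le_rfl]

theorem sum_fiberLaw {u : U} (hu : law P g u ≠ 0) : ∑ x, fiberLaw P g u x = 1 := by
  classical
  simp only [fiberLaw]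
  rw [← sum_filter, ← sum_div]
  exact div_self hu

theorem law_mul_fiberLaw (hP : ∀ x, 0 ≤ P x) (u : U) (x : X) :
    law P g u * fiberLaw P g u x = law P (fun x => (g x, x)) (u, x) := by
  classical
  have h : law P (fun x => (g x, x)) (u, x) = if g x = u then P x else 0 := by
    simp [law_eq_prob, prob_eq_sum_ite, and_comm, ite_and]
  rw [h, fiberLaw]
  split_ifs with hg
  · refine mul_div_cancel_of_imp' fun h0 => le_antisymm ?_ (hP x)
    exact h0 ▸ hg ▸ le_law hP g x
  · exact mul_zero _

variable [Fintype N]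

theorem blockLaw_nonneg (hP : ∀ x, 0 ≤ P x) (b : U × (N → X)) : 0 ≤ blockLaw P g b :=
  mul_nonneg (law_nonneg hP _ _) (piLaw_nonneg (fun _ => fiberLaw_nonneg hP _) _)

theorem map_satellite_of_blockLaw_ne_zero {b : U × (N → X)} (hb : blockLaw P g b ≠ 0) (s : N) :
    g (b.2 s) = b.1 := by
  have h := ne_zero_of_piLaw_ne_zero (right_ne_zero_of_mul hb) s
  by_contra hne
  exact h (if_neg hne)

variable [DecidableEq N] [Fintype U]

theorem law_blockLaw_comp [Fintype J] {e : J → N} (he : Function.Injective e) (u : U)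
    (v : J → X) :
    law (blockLaw P g) (fun b : U × (N → X) => (b.1, fun j => b.2 (e j))) (u, v) =
      law P g u * ∏ j, fiberLaw P g u (v j) := by
  refine (law_compProd (law P g) (fun u => piLaw fun _ : N => fiberLaw P g u)
    (fun x j => x (e j)) u v).trans ?_
  by_cases hu : law P g u = 0
  · simp [hu]
  · rw [law_piLaw_comp (fun _ => sum_fiberLaw hu) he fun _ x => x]
    simp only [law_id, piLaw]

theorem law_blockLaw_fst : law (blockLaw P g) (fun b : U × (N → X) => b.1) = law P g := by
  funext u
  simpa [law_eq_prob, Prod.ext_iff, funext_iff] using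
    law_blockLaw_comp (P := P) (g := g) (N := N) (Function.injective_of_subsingleton Empty.elim) u
      Empty.elim

theorem sum_blockLaw (hP : ∑ x, P x = 1) : ∑ b : U × (N → X), blockLaw P g b = 1 := by
  rw [← sum_law _ fun b : U × (N → X) => b.1, law_blockLaw_fst, sum_law, hP]

theorem law_blockLaw_satellite (hP : ∀ x, 0 ≤ P x) (s : N) :
    law (blockLaw P g) (fun b : U × (N → X) => b.2 s) = P := by
  have h : law (blockLaw P g) (fun b : U × (N → X) => (b.1, b.2 s)) =
      law P (fun x => (g x, x)) := by
    funext t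
    rw [← law_mul_fiberLaw hP]
    simpa [law_eq_prob, Prod.ext_iff, funext_iff] using
      law_blockLaw_comp (P := P) (g := g) (Function.injective_of_subsingleton fun _ : Unit => s)
        t.1 fun _ => t.2
  simpa only [law_law, law_id] using congrArg (fun q => law q Prod.snd) h

theorem isCondCopy_blockLaw {s s' : N} (hs : s ≠ s') :
    IsCondCopy (blockLaw P g) (fun b : U × (N → X) => b.2 s) (fun b => b.2 s') fun b => b.1 := by
  refine .of_law_eq_mul (μ := law P g) (ν := fiberLaw P g) (fun x x' u => ?_)
    fun _ => sum_fiberLaw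
  have h := law_blockLaw_comp (P := P) (g := g) (injective_pair_iff_ne.2 hs) u ![x, x']
  simp only [Fin.prod_univ_two, Matrix.cons_val_zero, Matrix.cons_val_one, ← mul_assoc] at h
  rw [← h]
  refine prob_congr fun b _ => ?_
  simp only [Prod.mk.injEq, funext_iff, Fin.forall_fin_two, Matrix.cons_val_zero,
    Matrix.cons_val_one]
  tauto

end Block

section Codebook

variable {ι Y : Type*} {X U C N : ι → Type*}

/-- A superposition codebook: for each user `i` and each cloud index in `C i`, a cloud center
and a satellite codeword for each index in `N i`. -/
abbrev Codebook (X U C N : ι → Type*) : Type _ :=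
  ∀ k : Σ i, C i, U k.1 × (N k.1 → X k.1)

/-- The codeword of user `i` for the message `w`. -/
def Codebook.word (ω : Codebook X U C N) (i : ι) (w : C i × N i) : X i :=
  (ω ⟨i, w.1⟩).2 w.2

/-- The cloud center of user `i` with index `c`. -/
def Codebook.cloud (ω : Codebook X U C N) (i : ι) (c : C i) : U i :=
  (ω ⟨i, c⟩).1

/-- Receiver `o` sees `F` of the cloud centers and confuses the cloud of its own message with
another one. -/
def Codebook.CloudError (ω : Codebook X U C N) (F : (∀ i, U i) → Y) (o : ι)
    (w : ∀ i, C i × N i) : Prop :=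
  ∃ c : ∀ i, C i, c o ≠ (w o).1 ∧
    F (fun i => ω.cloud i (c i)) = F fun i => ω.cloud i (w i).1

/-- A receiver that sees `f` of the codeword of user `i` confuses the message `w` with another
one. -/
def Codebook.WordError (ω : Codebook X U C N) {i : ι} (f : X i → Y) (w : C i × N i) : Prop :=
  ∃ w', w' ≠ w ∧ f (ω.word i w') = f (ω.word i w)

theorem card_filter_ne_iff_mem_le [Fintype ι] [∀ i, Fintype (C i)] [DecidableEq ι]
    [∀ i, DecidableEq (C i)] {D : Finset ι} (hD : D.Nonempty) (c : ∀ i, C i) :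
    #{c' : ∀ i, C i | ∀ i, c' i ≠ c i ↔ i ∈ D} ≤ ∏ i ∈ D, Fintype.card (C i) - 1 := by
  calc #{c' : ∀ i, C i | ∀ i, c' i ≠ c i ↔ i ∈ D}
    _ ≤ #(univ.erase (D.restrict c)) := by
        refine card_le_card_of_injOn D.restrict (fun c' hc' => ?_) fun c₁ h₁ c₂ h₂ h => ?_
        · obtain ⟨i, hi⟩ := hD
          simp only [coe_filter, mem_univ, true_and, Set.mem_ofPred_eq] at hc'
          exact mem_coe.2 <| mem_erase.2
            ⟨fun h => (hc' i).2 hi (congrFun h ⟨i, hi⟩), mem_univ _⟩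
        · simp only [coe_filter, mem_univ, true_and, Set.mem_ofPred_eq] at h₁ h₂
          funext i
          by_cases hi : i ∈ D
          · exact congrFun h ⟨i, hi⟩
          · rw [not_ne_iff.1 (mt (h₁ i).1 hi), not_ne_iff.1 (mt (h₂ i).1 hi)]
    _ = ∏ i ∈ D, Fintype.card (C i) - 1 := by
        rw [card_erase_of_mem (mem_univ _), card_univ, Fintype.card_pi,
          prod_coe_sort D fun i => Fintype.card (C i)]

variable [Fintype ι] [∀ i, Fintype (X i)] [∀ i, Fintype (C i)] [∀ i, Fintype (N i)]
  {P : ∀ i, X i → ℝ} {g : ∀ i, X i → U i}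

/-- The law of a random codebook with independent clouds. -/
noncomputable def bookLaw (P : ∀ i, X i → ℝ) (g : ∀ i, X i → U i) :
    Codebook X U C N → ℝ :=
  piLaw fun k => blockLaw (P k.1) (g k.1)

theorem bookLaw_nonneg (hP : ∀ i x, 0 ≤ P i x) (ω : Codebook X U C N) : 0 ≤ bookLaw P g ω :=
  piLaw_nonneg (fun k => blockLaw_nonneg (hP k.1)) ω

theorem map_word_of_bookLaw_ne_zero {ω : Codebook X U C N} (hω : bookLaw P g ω ≠ 0) (i : ι)
    (w : C i × N i) : g i (ω.word i w) = ω.cloud i w.1 :=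
  map_satellite_of_blockLaw_ne_zero (ne_zero_of_piLaw_ne_zero hω ⟨i, w.1⟩) w.2

variable [∀ i, Fintype (U i)] [DecidableEq ι] [∀ i, DecidableEq (C i)] [∀ i, DecidableEq (N i)]

theorem sum_bookLaw (hP1 : ∀ i, ∑ x, P i x = 1) :
    ∑ ω : Codebook X U C N, bookLaw P g ω = 1 :=
  sum_piLaw fun k => sum_blockLaw (hP1 k.1)

theorem law_bookLaw_comp {J : Type*} [Fintype J] {W : J → Type*} (hP1 : ∀ i, ∑ x, P i x = 1)
    {e : J → Σ i, C i} (he : Function.Injective e)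
    (r : ∀ j, U (e j).1 × (N (e j).1 → X (e j).1) → W j) :
    law (bookLaw P g) (fun ω : Codebook X U C N => fun j => r j (ω (e j))) =
      piLaw fun j => law (blockLaw (P (e j).1) (g (e j).1)) (r j) :=
  law_piLaw_comp (w := fun k : Σ i, C i => blockLaw (N := N k.1) (P k.1) (g k.1))
    (fun k => sum_blockLaw (hP1 k.1)) he r

theorem law_bookLaw_eval (hP1 : ∀ i, ∑ x, P i x = 1) (i : ι) (c : C i)
    (r : U i × (N i → X i) → Y) :
    law (bookLaw P g) (fun ω : Codebook X U C N => r (ω ⟨i, c⟩)) =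
      law (blockLaw (P i) (g i)) r :=
  law_piLaw_eval (w := fun k : Σ i, C i => blockLaw (N := N k.1) (P k.1) (g k.1))
    (fun k => sum_blockLaw (hP1 k.1)) ⟨i, c⟩ r

theorem law_bookLaw_words (hP : ∀ i x, 0 ≤ P i x) (hP1 : ∀ i, ∑ x, P i x = 1)
    (w : ∀ i, C i × N i) :
    law (bookLaw P g) (fun ω : Codebook X U C N => fun i => ω.word i (w i)) = piLaw P := by
  have h := law_bookLaw_comp (P := P) (g := g) (N := N) hP1 (e := fun i => ⟨i, (w i).1⟩)
    (fun i j h => congrArg Sigma.fst h) fun i b => b.2 (w i).2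
  simp only [law_blockLaw_satellite (hP _)] at h
  exact h

theorem law_bookLaw_word (hP : ∀ i x, 0 ≤ P i x) (hP1 : ∀ i, ∑ x, P i x = 1) (i : ι)
    (w : C i × N i) :
    law (bookLaw P g) (fun ω : Codebook X U C N => ω.word i w) = P i :=
  (law_bookLaw_eval hP1 i w.1 fun b => b.2 w.2).trans (law_blockLaw_satellite (hP i) w.2)

theorem isCondCopy_word_cloud (hP1 : ∀ i, ∑ x, P i x = 1) (i : ι) (c : C i) {s s' : N i}
    (hs : s ≠ s') :
    IsCondCopy (bookLaw P g) (fun ω : Codebook X U C N => ω.word i (c, s))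
      (fun ω => ω.word i (c, s')) fun ω => ω.cloud i c := by
  have h : law (bookLaw P g) (fun ω : Codebook X U C N => ω ⟨i, c⟩) = blockLaw (P i) (g i) :=
    (law_bookLaw_eval hP1 i c fun b => b).trans (law_id _)
  exact IsCondCopy.of_law (h ▸ isCondCopy_blockLaw hs)

theorem isCondCopy_word (hP : ∀ i x, 0 ≤ P i x) (hP1 : ∀ i, ∑ x, P i x = 1) (i : ι)
    {w w' : C i × N i} (hw : w.1 ≠ w'.1) :
    IsCondCopy (bookLaw P g) (fun ω : Codebook X U C N => ω.word i w) (fun ω => ω.word i w')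
      fun _ => () := by
  refine .of_law_eq_mul (μ := fun _ => 1) (ν := fun _ => P i) (fun x x' _ => ?_) fun _ _ => hP1 i
  have h := congrFun (law_bookLaw_comp hP1 (P := P) (g := g) (N := N)
    (e := fun j => ⟨i, ![w.1, w'.1] j⟩)
    (sigma_mk_injective.comp (injective_pair_iff_ne.2 hw)) fun j b => b.2 (![w.2, w'.2] j))
    ![x, x']
  simp only [piLaw, Fin.prod_univ_two, Matrix.cons_val_zero, Matrix.cons_val_one,
    law_blockLaw_satellite (hP i)] at h
  rw [one_mul, ← h]
  refine prob_congr fun ω _ => ?_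
  simp only [Prod.mk.injEq, funext_iff, Fin.forall_fin_two, Matrix.cons_val_zero,
    Matrix.cons_val_one, Codebook.word]
  tauto

theorem isCondCopy_clouds (hP1 : ∀ i, ∑ x, P i x = 1) {D : Finset ι} {c c' : ∀ i, C i}
    (hc : ∀ i ∈ D, c' i ≠ c i) :
    IsCondCopy (bookLaw P g) (fun (ω : Codebook X U C N) (i : {i // i ∈ D}) => ω.cloud i (c i))
      (fun ω i => ω.cloud i (c' i)) fun ω (i : {i // i ∉ D}) => ω.cloud i (c i) := by
  refine .of_law_eq_mul (μ := piLaw fun i : {i // i ∉ D} => law (P i) (g i))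
    (ν := fun _ => piLaw fun i : {i // i ∈ D} => law (P i) (g i)) (fun a a' b => ?_)
    fun _ _ => sum_piLaw fun i => (sum_law _ _).trans (hP1 i)
  have hinj {κ : Type _} {f : κ → ι} (hf : Function.Injective f) (c : ∀ i, C i) :
      Function.Injective fun k => (⟨f k, c (f k)⟩ : Σ i, C i) :=
    fun k l h => hf (congrArg Sigma.fst h)
  have hne (i : {i // i ∉ D}) (j : {j // j ∈ D}) (x : C i) (y : C j) :
      (⟨i, x⟩ : Σ i, C i) ≠ ⟨j, y⟩ := fun h =>
    ne_of_mem_of_not_mem j.2 i.2 (congrArg Sigma.fst h).symm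
  have hne' (i j : {j // j ∈ D}) : (⟨i, c i⟩ : Σ i, C i) ≠ ⟨j, c' j⟩ := fun h => by
    obtain rfl : i = j := Subtype.ext (congrArg Sigma.fst h)
    exact hc i i.2 (sigma_mk_injective h).symm
  have h := congrFun (law_bookLaw_comp hP1 (P := P) (g := g) (N := N)
    ((hinj Subtype.val_injective c).sumElim
      ((hinj Subtype.val_injective c).sumElim (hinj Subtype.val_injective c') hne')
      fun i => Sum.rec (fun j => hne i j _ _) fun j => hne i j _ _) fun j b => b.1)
    (Sum.rec b (Sum.rec a a'))
  simp only [piLaw, Fintype.prod_sum_type, law_blockLaw_fst, Sum.elim_inl, Sum.elim_inr,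
    ← mul_assoc] at h
  refine Eq.trans (prob_congr fun ω _ => ?_) h
  simp only [Prod.mk.injEq, funext_iff, Sum.forall, Codebook.cloud, Sum.elim_inl, Sum.elim_inr]
  tauto

theorem prob_exists_clouds_collision_le (hP : ∀ i x, 0 ≤ P i x) (hP1 : ∀ i, ∑ x, P i x = 1)
    (F : (∀ i, U i) → Y) {D : Finset ι} (hD : D.Nonempty) (w : ∀ i, C i × N i) :
    prob (bookLaw P g) (fun ω : Codebook X U C N => ∃ c : ∀ i, C i,
        (∀ i, c i ≠ (w i).1 ↔ i ∈ D) ∧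
          F (fun i => ω.cloud i (c i)) = F fun i => ω.cloud i (w i).1) ≤
      collisionBound (piLaw P) (fun x => F fun i => g i (x i))
        (fun x (i : {i // i ∉ D}) => g i (x i)) (∏ i ∈ D, Fintype.card (C i) - 1) := by
  let wrong : Finset (∀ i, C i) := {c | ∀ i, c i ≠ (w i).1 ↔ i ∈ D}
  obtain ⟨merge, hmerge⟩ : ∃ merge : ((∀ i : {i // i ∈ D}, U i) × ∀ i : {i // i ∉ D}, U i) →
      ∀ i, U i, ∀ u, merge (fun i => u i, fun i => u i) = u :=
    ⟨_, (Equiv.piEquivPiSubtypeProd (· ∈ D) U).left_inv⟩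
  have hmerge_cloud (ω : Codebook X U C N) (c : ∀ i, C i) :
      merge (fun i => ω.cloud i (c i), fun i => ω.cloud i (c i)) = fun i => ω.cloud i (c i) :=
    hmerge fun i => ω.cloud i (c i)
  calc prob (bookLaw P g) (fun ω : Codebook X U C N => ∃ c : ∀ i, C i,
          (∀ i, c i ≠ (w i).1 ↔ i ∈ D) ∧
            F (fun i => ω.cloud i (c i)) = F fun i => ω.cloud i (w i).1)
    _ = prob (bookLaw P g) fun ω : Codebook X U C N => ∃ c ∈ wrong,
          F (merge (fun i => ω.cloud i (c i), fun i => ω.cloud i (w i).1)) =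
            F (merge (fun i => ω.cloud i (w i).1, fun i => ω.cloud i (w i).1)) := by
        refine prob_congr fun ω _ => exists_congr fun c => ?_
        rw [mem_filter_univ]
        refine and_congr_right fun hc => ?_
        have hc' : (fun i : {i // i ∉ D} => ω.cloud i (w i).1) =
            fun i : {i // i ∉ D} => ω.cloud i (c i) :=
          funext fun i => congrArg (ω.cloud i) (not_ne_iff.1 (mt (hc i).1 i.2)).symm
        rw [hmerge_cloud ω fun i => (w i).1, hc', hmerge_cloud]
    _ ≤ collisionBound (bookLaw P g) (fun ω : Codebook X U C N => F (merge
          (fun i => ω.cloud i (w i).1, fun i => ω.cloud i (w i).1)))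
          (fun ω (i : {i // i ∉ D}) => ω.cloud i (w i).1) (∏ i ∈ D, Fintype.card (C i) - 1) :=
        prob_exists_collision_le (bookLaw_nonneg hP)
          (fun c hc => isCondCopy_clouds hP1 fun i => ((mem_filter_univ c).1 hc i).2)
          (fun b a => F (merge (a, b))) (card_filter_ne_iff_mem_le hD _)
    _ = collisionBound (bookLaw P g) (fun ω : Codebook X U C N => F fun i => g i (ω.word i (w i)))
          (fun ω (i : {i // i ∉ D}) => g i (ω.word i (w i)))
          (∏ i ∈ D, Fintype.card (C i) - 1) := by
        refine collisionBound_congr (fun ω ω' h h' => ?_) (fun ω ω' h h' => ?_) _ <;>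
          simp only [hmerge_cloud _ fun i => (w i).1, map_word_of_bookLaw_ne_zero h,
            map_word_of_bookLaw_ne_zero h']
    _ = _ := by rw [← law_bookLaw_words (g := g) hP hP1 w, collisionBound_law]

theorem prob_cloudError_le (hP : ∀ i x, 0 ≤ P i x) (hP1 : ∀ i, ∑ x, P i x = 1)
    (F : (∀ i, U i) → Y) (o : ι) (w : ∀ i, C i × N i) :
    prob (bookLaw P g) (fun ω : Codebook X U C N => ω.CloudError F o w) ≤
      ∑ D with o ∈ D, collisionBound (piLaw P) (fun x => F fun i => g i (x i))
        (fun x (i : {i // i ∉ D}) => g i (x i)) (∏ i ∈ D, Fintype.card (C i) - 1) := by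
  have hn : ∀ ω : Codebook X U C N, 0 ≤ bookLaw P g ω := bookLaw_nonneg hP
  refine le_trans ?_ ((prob_exists_le hn (univ.filter (o ∈ ·)) _).trans <| sum_le_sum fun D hD =>
    prob_exists_clouds_collision_le hP hP1 F ⟨o, (mem_filter.1 hD).2⟩ w)
  exact prob_mono hn fun ω _ ⟨c, hc, h⟩ =>
    ⟨univ.filter fun i => c i ≠ (w i).1, by simpa using hc, c, by simp, h⟩

theorem prob_wordError_le (hP : ∀ i x, 0 ≤ P i x) (hP1 : ∀ i, ∑ x, P i x = 1) (i : ι)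
    (f : X i → Y) (w : C i × N i) :
    prob (bookLaw P g) (fun ω : Codebook X U C N => ω.WordError f w) ≤
      collisionBound (P i) f (fun _ => ()) (Fintype.card (C i) * Fintype.card (N i) - 1) +
        collisionBound (P i) f (g i) (Fintype.card (N i) - 1) := by
  have hn : ∀ ω : Codebook X U C N, 0 ≤ bookLaw P g ω := bookLaw_nonneg hP
  let otherCloud : Finset (C i × N i) := {w' | w.1 ≠ w'.1}
  calc prob (bookLaw P g) (fun ω : Codebook X U C N => ω.WordError f w)
    _ ≤ prob (bookLaw P g) fun ω : Codebook X U C N =>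
          (∃ w' ∈ otherCloud, f (ω.word i w') = f (ω.word i w)) ∨
            ∃ s ∈ univ.erase w.2, f (ω.word i (w.1, s)) = f (ω.word i w) := by
        refine prob_mono hn fun ω _ ⟨w', hne, h⟩ => ?_
        by_cases hc : w.1 = w'.1
        · exact .inr ⟨w'.2, by simpa [Prod.ext_iff, hc] using hne, by rwa [hc]⟩
        · exact .inl ⟨w', by simpa [otherCloud] using hc, h⟩
    _ ≤ collisionBound (bookLaw P g) (fun ω : Codebook X U C N => f (ω.word i w)) (fun _ => ())
            (Fintype.card (C i) * Fintype.card (N i) - 1) +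
          collisionBound (bookLaw P g) (fun ω : Codebook X U C N => f (ω.word i w))
            (fun ω => ω.cloud i w.1) (Fintype.card (N i) - 1) := by
        refine (prob_or_le hn _ _).trans (add_le_add ?_ ?_)
        · refine prob_exists_collision_le hn (fun w' hw' => isCondCopy_word hP hP1 i ?_)
            (fun _ => f) ?_
          · exact (mem_filter.1 hw').2
          · rw [← Fintype.card_prod]
            exact Nat.le_sub_one_of_lt (card_lt_univ_of_notMem (x := w) (by simp [otherCloud]))
        · refine prob_exists_collision_le hn
            (fun s hs => isCondCopy_word_cloud hP1 i w.1 (ne_of_mem_erase hs).symm) (fun _ => f) ?_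
          rw [card_erase_of_mem (mem_univ _), card_univ]
    _ = collisionBound (bookLaw P g) (fun ω : Codebook X U C N => f (ω.word i w)) (fun _ => ())
            (Fintype.card (C i) * Fintype.card (N i) - 1) +
          collisionBound (bookLaw P g) (fun ω : Codebook X U C N => f (ω.word i w))
            (fun ω => g i (ω.word i w)) (Fintype.card (N i) - 1) := by
        congr 1
        refine collisionBound_congr (fun _ _ _ _ => Iff.rfl) (fun ω ω' h h' => ?_) _
        rw [map_word_of_bookLaw_ne_zero h, map_word_of_bookLaw_ne_zero h']
    _ = _ := by
        rw [← law_bookLaw_word (g := g) hP hP1 i w, collisionBound_law, collisionBound_law]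

end Codebook

/-! ### Existence of codes -/

theorem exists_prob_le_of_forall_prob_le {Ω W : Type*} [Fintype Ω] [Fintype W] {q : Ω → ℝ}
    {r : W → ℝ} (hq : ∀ ω, 0 ≤ q ω) (hq1 : ∑ ω, q ω = 1) (hr : ∀ w, 0 ≤ r w)
    (hr1 : ∑ w, r w = 1) {E : Ω → W → Prop} {β : ℝ} (h : ∀ w, prob q (fun ω => E ω w) ≤ β) :
    ∃ ω, q ω ≠ 0 ∧ prob r (E ω) ≤ β := by
  classical
  obtain ⟨ω₀, -, hω₀⟩ : ∃ ω ∈ univ, q ω ≠ 0 :=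
    exists_ne_zero_of_sum_ne_zero (hq1.trans_ne one_ne_zero)
  obtain ⟨ω, hω, hle⟩ : ∃ ω ∈ univ.filter (q · ≠ 0), q ω * prob r (E ω) ≤ q ω * β := by
    refine exists_le_of_sum_le ⟨ω₀, mem_filter.2 ⟨mem_univ _, hω₀⟩⟩ ?_
    rw [sum_filter_of_ne fun ω _ => left_ne_zero_of_mul,
      sum_filter_of_ne fun ω _ => left_ne_zero_of_mul]
    calc ∑ ω, q ω * prob r (E ω)
      _ = ∑ w, r w * prob q (fun ω => E ω w) := by
          simp only [prob_eq_sum_ite, mul_sum, mul_ite, mul_zero]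
          rw [sum_comm]
          simp only [mul_comm]
      _ ≤ ∑ w, r w * β := sum_le_sum fun w _ => mul_le_mul_of_nonneg_left (h w) (hr w)
      _ = ∑ ω, q ω * β := by rw [← sum_mul, ← sum_mul, hr1, hq1]
  exact ⟨ω, (mem_filter.1 hω).2,
    le_of_mul_le_mul_left hle ((hq ω).lt_of_ne' (mem_filter.1 hω).2)⟩

section Code

variable {n : ℕ} {X Y : Fin (n + 1) → Type*} {V τ : Type*} [Fintype τ] [Nonempty τ]

theorem Channel.exists_code_of_fintype (C : Channel X Y V) {W : Fin (n + 1) → Type*}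
    [∀ i, Fintype (W i)] [∀ i, Nonempty (W i)] (enc : ∀ i, W i → τ → X i)
    (dec : ∀ i, (τ → Y i) → W i) :
    ∃ c : Code X Y, c.T = Fintype.card τ ∧ (∀ i, c.M i = Fintype.card (W i)) ∧
      c.errorProb C = prob (fun _ => (∏ i, (Fintype.card (W i) : ℝ))⁻¹) (fun w : ∀ i, W i =>
        ∃ i, dec i (fun t => C.y (fun j => enc j (w j) t) i) ≠ w i) := by
  classical
  let eτ := Fintype.equivFin τ
  let eW := fun i => Fintype.equivFin (W i)
  refine ⟨⟨Fintype.card τ, Fintype.card_pos, fun i => Fintype.card (W i),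
    fun i => Fintype.card_pos, fun i m t => enc i ((eW i).symm m) (eτ.symm t),
    fun i y => eW i (dec i fun t => y (eτ t))⟩, rfl, fun _ => rfl, ?_⟩
  rw [Code.errorProb, prob, sum_const, nsmul_eq_mul, div_eq_mul_inv]
  congr 2
  refine card_equiv (Equiv.piCongrRight fun i => (eW i).symm) fun w => ?_
  simp only [mem_filter_univ]
  refine exists_congr fun i => not_congr ?_
  simp only [Code.decoded, Equiv.symm_apply_apply, Equiv.piCongrRight_apply, Pi.map_apply]
  rw [← Equiv.eq_symm_apply]

theorem Channel.exists_code_of_codebook (C : Channel X Y V) {U K N : Fin (n + 1) → Type*}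
    [∀ i, Fintype (K i)] [∀ i, Nonempty (K i)] [∀ i, Fintype (N i)] [∀ i, Nonempty (N i)]
    [Subsingleton (N 0)] {g : ∀ i, X i → U i} {F : (∀ i, U i) → Y 0}
    (hF : ∀ x, F (fun i => g i (x i)) = C.y x 0)
    (ω : Codebook (fun i => τ → X i) (fun i => τ → U i) K N)
    (hω : ∀ i w, (fun t => g i (ω.word i w t)) = ω.cloud i w.1) :
    ∃ c : Code X Y, c.T = Fintype.card τ ∧
      (∀ i, c.M i = Fintype.card (K i) * Fintype.card (N i)) ∧
      c.errorProb C ≤ prob (fun _ => (∏ i, (Fintype.card (K i × N i) : ℝ))⁻¹) fun w =>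
        ω.CloudError (fun u t => F fun i => u i t) 0 w ∨
          ∃ i ∈ univ, ω.WordError (fun x t => C.out i (x t)) (w (Fin.succ i)) := by
  let y₀ (c : ∀ i, K i) (t : τ) : Y 0 := F fun i => ω.cloud i (c i) t
  let y (i : Fin n) (w : K i.succ × N i.succ) (t : τ) : Y i.succ := C.out i (ω.word i.succ w t)
  obtain ⟨c, hT, hM, herr⟩ := C.exists_code_of_fintype (fun i w => ω.word i w) <|
    Fin.cons (fun z => (Function.invFun y₀ z 0, Classical.arbitrary (N 0)))
      fun i => Function.invFun (y i)
  refine ⟨c, hT, fun i => (hM i).trans (Fintype.card_prod _ _), herr.trans_le ?_⟩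
  refine prob_mono (fun _ => inv_nonneg.2 (prod_nonneg fun _ _ => Nat.cast_nonneg _)) ?_
  rintro w - ⟨i, hi⟩
  cases i using Fin.cases with
  | zero =>
    have hy : (fun t => C.y (fun j => ω.word j (w j) t) 0) = y₀ fun i => (w i).1 := by
      funext t
      rw [← hF]
      exact congrArg F (funext fun i => congrFun (hω i (w i)) t)
    rw [hy] at hi
    exact .inl ⟨_, fun h => hi (Prod.ext h (Subsingleton.elim _ _)),
      Function.invFun_eq (f := y₀) ⟨fun i => (w i).1, rfl⟩⟩
  | succ i =>
    exact .inr ⟨i, mem_univ i, _, hi, Function.invFun_eq (f := y i) ⟨w i.succ, rfl⟩⟩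

end Code

section Block

variable {τ Ω α β : Type*} [Fintype τ] [Fintype Ω]

/-- The bound `collisionBound` for `card τ` independent uses of a memoryless source: slot `t` has
law `q t`, and `A` and `B` are applied in each slot. -/
noncomputable def blockCollisionBound [DecidableEq τ] (q : τ → Ω → ℝ) (A : Ω → α) (B : Ω → β)
    (k : ℕ) : ℝ :=
  collisionBound (piLaw q) (fun z t => A (z t)) (fun z t => B (z t)) k

variable [DecidableEq τ] {ι : Type*} [Fintype ι] [DecidableEq ι] {X : ι → Type*}
  [∀ i, Fintype (X i)]

theorem collisionBound_piLaw_swap {U : ι → Type*} (p : τ → ∀ i, X i → ℝ) (A : (∀ i, X i) → α)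
    (g : ∀ i, X i → U i) (D : Finset ι) (k : ℕ) :
    collisionBound (piLaw fun i => piLaw fun t => p t i) (fun x t => A fun i => x i t)
      (fun x (i : {i // i ∉ D}) t => g i (x i t)) k =
    blockCollisionBound (fun t => piLaw (p t)) A (fun x (i : {i // i ∉ D}) => g i (x i)) k := by
  have hlaw : law (piLaw fun i => piLaw fun t => p t i) (fun (x : ∀ i, τ → X i) t i => x i t) =
      piLaw fun t => piLaw (p t) := by
    funext z
    exact (law_equiv _ (Equiv.piComm fun (i : ι) (_ : τ) => X i) z).trans prod_comm
  rw [blockCollisionBound, ← hlaw, collisionBound_law]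
  refine collisionBound_congr (fun _ _ _ _ => Iff.rfl) (fun _ _ _ _ => ?_) _
  simp only [funext_iff]
  exact forall_comm

theorem collisionBound_piLaw_eval {p : τ → ∀ i, X i → ℝ} (hp : ∀ t i, ∑ x, p t i x = 1) (i : ι)
    (f : X i → α) (h : X i → β) (k : ℕ) :
    collisionBound (piLaw fun t => p t i) (fun x t => f (x t)) (fun x t => h (x t)) k =
      blockCollisionBound (fun t => piLaw (p t)) (fun x => f (x i)) (fun x => h (x i)) k := by
  have hlaw : law (piLaw fun t => piLaw (p t)) (fun (z : τ → ∀ i, X i) t => z t i) =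
      piLaw fun t => p t i := by
    refine (law_piLaw_comp (e := id) (fun t => sum_piLaw (hp t)) Function.injective_id
      fun _ z => z i).trans (congrArg piLaw (funext fun t => ?_))
    exact (law_piLaw_eval (hp t) i fun x => x).trans (law_id _)
  rw [blockCollisionBound, ← hlaw, collisionBound_law]

end Block

section RandomCode

variable {n : ℕ} {X Y U : Fin (n + 1) → Type*} {V τ : Type*} [Fintype τ] [DecidableEq τ]
  [Nonempty τ] [∀ i, Fintype (X i)] [∀ i, Finite (U i)]

theorem Channel.exists_code_errorProb_le (C : Channel X Y V) {g : ∀ i, X i → U i}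
    {F : (∀ i, U i) → Y 0} (hF : ∀ x, F (fun i => g i (x i)) = C.y x 0)
    {p : τ → ∀ i, X i → ℝ} (hp : ∀ t i, p t i ∈ stdSimplex ℝ (X i)) {M L : Fin (n + 1) → ℕ}
    (hM : ∀ i, M i ≠ 0) (hL : ∀ i, L i ≠ 0) (hL0 : L 0 = 1) :
    ∃ c : Code X Y, c.T = Fintype.card τ ∧ (∀ i, c.M i = M i * L i) ∧
      c.errorProb C ≤
        ∑ D with 0 ∈ D, blockCollisionBound (fun t => prodLaw (p t)) (fun x => C.y x 0)
          (fun x (i : {i // i ∉ D}) => g i (x i)) (∏ i ∈ D, M i - 1) +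
        ∑ i : Fin n,
          (blockCollisionBound (fun t => prodLaw (p t)) (fun x => C.y x i.succ) (fun _ => ())
            (M i.succ * L i.succ - 1) +
          blockCollisionBound (fun t => prodLaw (p t)) (fun x => C.y x i.succ)
            (fun x => g i.succ (x i.succ)) (L i.succ - 1)) := by
  have hU (i) := Fintype.ofFinite (U i)
  have hMn (i) : NeZero (M i) := ⟨hM i⟩
  have hLn (i) : NeZero (L i) := ⟨hL i⟩
  have hL0' : Subsingleton (Fin (L 0)) := by rw [hL0]; infer_instance
  let P (i) : (τ → X i) → ℝ := piLaw fun t => p t i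
  let G (i) (x : τ → X i) (t : τ) : U i := g i (x t)
  have hP : ∀ i x, 0 ≤ P i x := fun i => piLaw_nonneg fun t => (hp t i).1
  have hP1 : ∀ i, ∑ x, P i x = 1 := fun i => sum_piLaw fun t => (hp t i).2
  let K (i) := Fin (M i)
  let N (i) := Fin (L i)
  have huniform : ∑ _w : ∀ i, K i × N i, (∏ i, (Fintype.card (K i × N i) : ℝ))⁻¹ = 1 := by
    simp [Fintype.card_pi, K, N, prod_eq_zero_iff, hM, hL]
  have hn : ∀ ω : Codebook _ _ K N, 0 ≤ bookLaw P G ω := bookLaw_nonneg hP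
  obtain ⟨ω, hω, hle⟩ := exists_prob_le_of_forall_prob_le
    (E := fun (ω : Codebook _ _ K N) w => ω.CloudError (fun u t => F fun i => u i t) 0 w ∨
      ∃ i ∈ univ, ω.WordError (fun x t => C.out i (x t)) (w (Fin.succ i)))
    hn (sum_bookLaw hP1) (fun _ => inv_nonneg.2 (prod_nonneg fun _ _ => Nat.cast_nonneg _))
    huniform fun w => (prob_or_le hn _ _).trans <|
      add_le_add (prob_cloudError_le hP hP1 _ 0 w) <|
        (prob_exists_le hn _ _).trans <| sum_le_sum fun i _ =>
          prob_wordError_le hP hP1 i.succ _ (w i.succ)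
  obtain ⟨c, hT, hcM, hc⟩ := C.exists_code_of_codebook hF ω (map_word_of_bookLaw_ne_zero hω)
  refine ⟨c, hT, fun i => by simp [hcM, K, N], (hc.trans hle).trans_eq ?_⟩
  have hp1 : ∀ t i, ∑ x, p t i x = 1 := fun t i => (hp t i).2
  simp only [K, N, Fintype.card_fin]
  refine congrArg₂ _ (sum_congr rfl fun D _ => ?_) (sum_congr rfl fun i _ => congrArg₂ _ ?_ ?_)
  · simp only [G, hF]
    exact collisionBound_piLaw_swap p (fun x => C.y x 0) g D _
  · refine Eq.trans (collisionBound_congr (fun _ _ _ _ => Iff.rfl) (fun _ _ _ _ => ?_) _)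
      (collisionBound_piLaw_eval hp1 i.succ (C.out i) (fun _ => ()) _)
    simp only
  · exact collisionBound_piLaw_eval hp1 i.succ (C.out i) (g i.succ) _

end RandomCode

/-! ### The error exponent of independent channel uses -/

section Exponent

variable {Ω α β : Type*} [Fintype Ω]

/-- The moment of order `ρ` of the conditional probability of `A` given `B`. -/
noncomputable def condMoment (q : Ω → ℝ) (A : Ω → α) (B : Ω → β) (ρ : ℝ) : ℝ :=
  ∑ ω, q ω * condProb q A B ω ^ ρ

theorem condMoment_nonneg {q : Ω → ℝ} (hq : ∀ ω, 0 ≤ q ω) (A : Ω → α) (B : Ω → β) (ρ : ℝ) :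
    0 ≤ condMoment q A B ρ :=
  sum_nonneg fun ω _ => mul_nonneg (hq ω) (Real.rpow_nonneg (condProb_nonneg hq A B ω) ρ)

theorem condMoment_zero (q : Ω → ℝ) (A : Ω → α) (B : Ω → β) :
    condMoment q A B 0 = ∑ ω, q ω := by
  simp only [condMoment, Real.rpow_zero, mul_one]

theorem hasDerivAt_condMoment [Fintype α] [Fintype β] {q : Ω → ℝ} (hq : ∀ ω, 0 ≤ q ω)
    (A : Ω → α) (B : Ω → β) :
    HasDerivAt (condMoment q A B) (-(Real.log 2 * condEntropy q A B)) 0 := by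
  have h (ω : Ω) : HasDerivAt (fun ρ : ℝ => q ω * condProb q A B ω ^ ρ)
      (q ω * Real.log (condProb q A B ω)) 0 := by
    by_cases h0 : q ω = 0
    · simpa [h0] using hasDerivAt_const (0 : ℝ) (0 : ℝ)
    · simpa using ((hasDerivAt_id (0 : ℝ)).const_rpow (condProb_pos hq A B h0)).const_mul (q ω)
  refine (HasDerivAt.fun_sum fun ω (_ : ω ∈ univ) => h ω).congr_deriv ?_
  rw [condEntropy_eq_sum, mul_neg, neg_neg, mul_sum]
  refine sum_congr rfl fun ω _ => ?_
  rw [mul_left_comm, Real.logb, mul_div_cancel₀ _ (Real.log_pos one_lt_two).ne']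

theorem min_one_le_rpow {z ρ : ℝ} (hz : 0 ≤ z) (hρ : 0 ≤ ρ) (hρ1 : ρ ≤ 1) : min 1 z ≤ z ^ ρ := by
  rcases le_total z 1 with h | h
  · exact (min_le_right _ _).trans (Real.self_le_rpow_of_le_one hz h hρ1)
  · exact (min_le_left _ _).trans (Real.one_le_rpow h hρ)

theorem blockCollisionBound_nonneg {τ : Type*} [Fintype τ] [DecidableEq τ] {q : τ → Ω → ℝ}
    (hq : ∀ t ω, 0 ≤ q t ω) (A : Ω → α) (B : Ω → β) (k : ℕ) :
    0 ≤ blockCollisionBound q A B k :=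
  collisionBound_nonneg (piLaw_nonneg hq) _ _ k

theorem blockCollisionBound_le {τ : Type*} [Fintype τ] [DecidableEq τ] {q : τ → Ω → ℝ}
    (hq : ∀ t ω, 0 ≤ q t ω) (A : Ω → α) (B : Ω → β) (k : ℕ) {ρ : ℝ} (hρ : 0 ≤ ρ) (hρ1 : ρ ≤ 1) :
    blockCollisionBound q A B k ≤ k ^ ρ * ∏ t, condMoment (q t) A B ρ := by
  have hc (t : τ) (ω : Ω) : 0 ≤ condProb (q t) A B ω := condProb_nonneg (hq t) A B ω
  calc blockCollisionBound q A B k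
    _ ≤ ∑ z, piLaw q z * ((k : ℝ) ^ ρ * ∏ t, condProb (q t) A B (z t) ^ ρ) := by
        refine sum_le_sum fun z _ => mul_le_mul_of_nonneg_left ?_ (piLaw_nonneg hq z)
        rw [condProb_piLaw, Real.finsetProd_rpow _ _ fun t _ => hc t _,
          ← Real.mul_rpow k.cast_nonneg (prod_nonneg fun t _ => hc t _)]
        exact min_one_le_rpow (mul_nonneg k.cast_nonneg (prod_nonneg fun t _ => hc t _)) hρ hρ1
    _ = k ^ ρ * ∏ t, condMoment (q t) A B ρ := by
        simp only [mul_left_comm _ ((k : ℝ) ^ ρ), ← mul_sum]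
        rw [sum_piLaw_mul_prod q fun t ω => condProb (q t) A B ω ^ ρ]
        rfl

variable {σ : Type*} [Fintype σ] [Fintype α] [Fintype β] {q : σ → Ω → ℝ}

theorem exists_rpow_mul_prod_condMoment_lt_one (hq : ∀ s ω, 0 ≤ q s ω)
    (hq1 : ∀ s, ∑ ω, q s ω = 1) {A : Ω → α} {B : Ω → β} {d : ℝ}
    (hd : d < ∑ s, condEntropy (q s) A B) :
    ∃ ρ : ℝ, 0 < ρ ∧ ρ ≤ 1 ∧ (2 : ℝ) ^ (d * ρ) * ∏ s, condMoment (q s) A B ρ < 1 := by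
  classical
  have hlog : 0 < Real.log 2 := Real.log_pos one_lt_two
  let f (ρ : ℝ) : ℝ := (2 : ℝ) ^ (d * ρ) * ∏ s, condMoment (q s) A B ρ
  have hderiv : HasDerivAt f (Real.log 2 * (d - ∑ s, condEntropy (q s) A B)) 0 := by
    refine ((((hasDerivAt_id (0 : ℝ)).const_mul d).const_rpow two_pos).mul
      (HasDerivAt.fun_finsetProd fun s (_ : s ∈ univ) =>
        hasDerivAt_condMoment (hq s) A B)).congr_deriv ?_
    simp only [mul_one, id_eq, mul_zero, Real.rpow_zero, condMoment_zero, hq1, prod_const_one,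
      smul_eq_mul, mul_neg, one_mul, sum_neg_distrib, ← mul_sum]
    ring
  have hslope := hderiv.tendsto_slope_zero_right.eventually_lt_const
    (mul_neg_of_pos_of_neg hlog (sub_neg.2 hd))
  obtain ⟨ρ, hρslope, hρ⟩ :=
    (hslope.and (Ioc_mem_nhdsGT (zero_lt_one (α := ℝ)))).exists
  have h0 : f 0 = 1 := by simp [f, condMoment_zero, hq1]
  rw [zero_add, h0, smul_eq_mul, inv_mul_lt_iff₀ hρ.1, mul_zero, sub_neg] at hρslope
  exact ⟨ρ, hρ.1, hρ.2, hρslope⟩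

variable [DecidableEq σ]

theorem tendsto_blockCollisionBound (hq : ∀ s ω, 0 ≤ q s ω) (hq1 : ∀ s, ∑ ω, q s ω = 1)
    {A : Ω → α} {B : Ω → β} {d : ℕ} (hd : d = 0 ∨ (d : ℝ) < ∑ s, condEntropy (q s) A B) :
    Filter.Tendsto (fun m : ℕ =>
        blockCollisionBound (fun t : Fin (m + 1) × σ => q t.2) A B (2 ^ ((m + 1) * d) - 1))
      Filter.atTop (nhds 0) := by
  rcases hd with rfl | hd
  · simp [blockCollisionBound, collisionBound]
  obtain ⟨ρ, hρ, hρ1, hlt⟩ := exists_rpow_mul_prod_condMoment_lt_one hq hq1 hd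
  have hprod : 0 ≤ ∏ s, condMoment (q s) A B ρ :=
    prod_nonneg fun s _ => condMoment_nonneg (hq s) A B ρ
  have hq' (m : ℕ) : ∀ (t : Fin (m + 1) × σ) (ω : Ω), 0 ≤ q t.2 ω := fun t => hq t.2
  have hlim := (tendsto_pow_atTop_nhds_zero_of_lt_one
    (mul_nonneg (Real.rpow_nonneg two_pos.le _) hprod) hlt).comp (Filter.tendsto_add_atTop_nat 1)
  refine squeeze_zero (fun m => ?_) (fun m => ?_) hlim
  · exact blockCollisionBound_nonneg (hq' m) A B _
  calc blockCollisionBound (fun t : Fin (m + 1) × σ => q t.2) A B (2 ^ ((m + 1) * d) - 1)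
    _ ≤ ((2 ^ ((m + 1) * d) - 1 : ℕ) : ℝ) ^ ρ *
          ∏ t : Fin (m + 1) × σ, condMoment (q t.2) A B ρ :=
        blockCollisionBound_le (hq' m) A B _ hρ.le hρ1
    _ ≤ ((2 : ℝ) ^ ((m + 1) * d)) ^ ρ * (∏ s, condMoment (q s) A B ρ) ^ (m + 1) := by
        simp only [Fintype.prod_prod_type, prod_const, card_univ, Fintype.card_fin]
        gcongr
        exact_mod_cast Nat.sub_le _ _
    _ = ((2 : ℝ) ^ (d * ρ) * ∏ s, condMoment (q s) A B ρ) ^ (m + 1) := by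
        rw [mul_pow, ← Real.rpow_natCast, ← Real.rpow_mul two_pos.le, ← Real.rpow_mul_natCast
          two_pos.le]
        push_cast
        ring_nf

end Exponent

/-! ### Achievable rates -/

section Achievable

variable {n : ℕ} {X Y U : Fin (n + 1) → Type*} {V : Type*} [∀ i, Fintype (X i)]
  [∀ i, Fintype (Y i)]

theorem prodLaw_nonneg {p : ∀ i, X i → ℝ} (hp : ∀ i, p i ∈ stdSimplex ℝ (X i)) (x : ∀ i, X i) :
    0 ≤ prodLaw p x :=
  piLaw_nonneg (fun i => (hp i).1) x

theorem sum_prodLaw {p : ∀ i, X i → ℝ} (hp : ∀ i, p i ∈ stdSimplex ℝ (X i)) :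
    ∑ x, prodLaw p x = 1 :=
  sum_piLaw fun i => (hp i).2

variable [∀ i, Fintype (U i)] {σ : Type*} [Fintype σ] [Nonempty σ]

theorem Channel.achievable_of_lt_sum_condEntropy (C : Channel X Y V) {g : ∀ i, X i → U i}
    {F : (∀ i, U i) → Y 0} (hF : ∀ x, F (fun i => g i (x i)) = C.y x 0)
    {p : σ → ∀ i, X i → ℝ} (hp : ∀ s i, p s i ∈ stdSimplex ℝ (X i)) {a b : Fin (n + 1) → ℕ}
    (hb : b 0 = 0)
    (hcloud : ∀ D : Finset (Fin (n + 1)), 0 ∈ D → ∑ i ∈ D, a i = 0 ∨ ((∑ i ∈ D, a i : ℕ) : ℝ) <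
      ∑ s, condEntropy (prodLaw (p s)) (fun x => C.y x 0) fun x (i : {i // i ∉ D}) => g i (x i))
    (hword : ∀ i : Fin n, a i.succ + b i.succ = 0 ∨ ((a i.succ + b i.succ : ℕ) : ℝ) <
      ∑ s, condEntropy (prodLaw (p s)) (fun x => C.y x i.succ) fun _ => ())
    (hsatellite : ∀ i : Fin n, b i.succ = 0 ∨ (b i.succ : ℝ) <
      ∑ s, condEntropy (prodLaw (p s)) (fun x => C.y x i.succ) fun x => g i.succ (x i.succ)) :
    C.Achievable fun i => ((a i + b i : ℕ) : ℝ) / Fintype.card σ := by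
  classical
  have hσ : 0 < Fintype.card σ := Fintype.card_pos
  choose c hT hM herr using fun m : ℕ => C.exists_code_errorProb_le hF
    (p := fun t : Fin (m + 1) × σ => p t.2) (fun t => hp t.2)
    (M := fun i => 2 ^ ((m + 1) * a i)) (L := fun i => 2 ^ ((m + 1) * b i))
    (fun i => by positivity) (fun i => by positivity) (by simp [hb])
  replace hT (m) : (c m).T = (m + 1) * Fintype.card σ := by
    rw [hT, Fintype.card_prod, Fintype.card_fin]
  refine ⟨c, fun m => funext fun i => ?_, ?_, ?_⟩
  · rw [Code.rate, hM, hT, ← pow_add, ← mul_add, Nat.cast_pow, Nat.cast_ofNat, Real.logb_pow,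
      Real.logb_self_eq_one one_lt_two, mul_one, Nat.cast_mul, Nat.cast_mul,
      mul_div_mul_left _ _ (Nat.cast_ne_zero.2 m.succ_ne_zero)]
  · simp only [hT]
    exact Filter.tendsto_atTop_mono (fun m => Nat.le_mul_of_pos_right _ hσ)
      (Filter.tendsto_add_atTop_nat 1)
  · have hq (s) : ∀ x, 0 ≤ prodLaw (p s) x := prodLaw_nonneg (hp s)
    have hq1 (s) : ∑ x, prodLaw (p s) x = 1 := sum_prodLaw (hp s)
    have hlim := (tendsto_finsetSum (univ.filter (0 ∈ ·)) fun D hD =>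
        tendsto_blockCollisionBound hq hq1 (hcloud D (mem_filter.1 hD).2)).add
      (tendsto_finsetSum univ fun i _ => (tendsto_blockCollisionBound hq hq1 (hword i)).add
        (tendsto_blockCollisionBound hq hq1 (hsatellite i)))
    simp only [add_zero, sum_const_zero] at hlim
    refine squeeze_zero (fun m => ?_) (fun m => ?_) hlim
    · exact div_nonneg (Nat.cast_nonneg _) (prod_nonneg fun _ _ => Nat.cast_nonneg _)
    · simpa only [prod_pow_eq_pow_sum, ← mul_sum, ← pow_add, ← mul_add] using herr m

end Achievable

/-! ### Rate splitting -/

section RateSplit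

variable {n : ℕ} {X Y : Fin (n + 1) → Type*} {V : Type*} [∀ i, Fintype (X i)]
  [∀ i, Fintype (Y i)]

/-- The splitting of the rates `R i` into satellite rates `r i` and cloud rates `R i - r i`
satisfies the constraints of superposition coding with cloud centers `g i (x i)`. -/
structure IsRateSplit {U : Fin (n + 1) → Type*} [∀ i, Fintype (U i)] (C : Channel X Y V)
    (g : ∀ i, X i → U i) (p : ∀ i, X i → ℝ) (R r : Fin (n + 1) → ℝ) : Prop where
  satellite_zero : r 0 = 0
  satellite_nonneg : ∀ i, 0 ≤ r i
  satellite_le : ∀ i, r i ≤ R i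
  sum_cloud_le : ∀ D : Finset (Fin (n + 1)), 0 ∈ D → ∑ i ∈ D, (R i - r i) ≤
    condEntropy (prodLaw p) (fun x => C.y x 0) fun x (i : {i // i ∉ D}) => g i (x i)
  rate_le : ∀ i : Fin n, R i.succ ≤
    condEntropy (prodLaw p) (fun x => C.y x i.succ) fun _ => ()
  satellite_le_condEntropy : ∀ i : Fin n, r i.succ ≤
    condEntropy (prodLaw p) (fun x => C.y x i.succ) fun x => g i.succ (x i.succ)

theorem sum_eq_add_sum_succ_of_zero_mem {M : Type*} [AddCommMonoid M] {D : Finset (Fin (n + 1))}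
    (hD : 0 ∈ D) (f : Fin (n + 1) → M) :
    ∑ i ∈ D, f i = f 0 + ∑ i : Fin n with i.succ ∈ D, f i.succ := by
  rw [← sum_ite_mem_eq D f, Fin.sum_univ_succ, if_pos hD, sum_filter]

variable [Fintype V] {U : Fin n → Type*} [∀ i, Fintype (U i)] {C : Channel X Y V}
  {g : ∀ i : Fin n, X i.succ → U i} {p : ∀ i, X i → ℝ} {R : Fin (n + 1) → ℝ}

theorem Channel.add_sum_sub_min_le_of_mem_rateRegion (hp : ∀ i, p i ∈ stdSimplex ℝ (X i))
    (hR : R ∈ C.rateRegion g p) (S : Finset (Fin n)) :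
    R 0 + ∑ i ∈ S, (R i.succ - min (R i.succ)
        (condEntropy (prodLaw p) (fun x => C.y x i.succ) fun x => g i (x i.succ))) ≤
      condEntropy (prodLaw p) (fun x => C.y x 0) (auxCompl g S) := by
  classical
  set h : Fin n → ℝ := fun i =>
    condEntropy (prodLaw p) (fun x => C.y x i.succ) fun x => g i (x i.succ)
  -- Only the users with `H(Y_i|U_i) < R_i` contribute, so their constraint is the strongest one.
  let S' : Finset (Fin n) := S.filter fun i => h i < R i.succ
  have hsum : ∑ i ∈ S, (R i.succ - min (R i.succ) (h i)) = ∑ i ∈ S', (R i.succ - h i) := by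
    rw [sum_filter]
    refine sum_congr rfl fun i _ => ?_
    split_ifs with hi
    · rw [min_eq_right hi.le]
    · rw [min_eq_left (not_lt.1 hi), sub_self]
  have hmono : condEntropy (prodLaw p) (fun x => C.y x 0) (auxCompl g S') ≤
      condEntropy (prodLaw p) (fun x => C.y x 0) (auxCompl g S) :=
    condEntropy_le_comp (prodLaw_nonneg hp) _ (auxCompl g S')
      fun u (i : {i // i ∉ S}) => u ⟨i, fun hi => i.2 (mem_filter.1 hi).1⟩
  calc R 0 + ∑ i ∈ S, (R i.succ - min (R i.succ) (h i))
    _ = R 0 + ∑ i ∈ S', R i.succ - ∑ i ∈ S', h i := by rw [hsum, sum_sub_distrib, add_sub_assoc]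
    _ ≤ condEntropy (prodLaw p) (fun x => C.y x 0) (auxCompl g S') := by
        rw [sub_le_iff_le_add]
        convert hR.2.2.2 S'
    _ ≤ condEntropy (prodLaw p) (fun x => C.y x 0) (auxCompl g S) := hmono

theorem Channel.exists_isRateSplit_of_mem_rateRegion (hp : ∀ i, p i ∈ stdSimplex ℝ (X i))
    (hR : R ∈ C.rateRegion g p) {U' : Fin (n + 1) → Type*} [∀ i, Fintype (U' i)]
    {g' : ∀ i, X i → U' i}
    (hg' : ∀ (i : Fin n) x y, g i x = g i y ↔ g' i.succ x = g' i.succ y) :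
    ∃ r, IsRateSplit C g' p R r := by
  have hq : ∀ x, 0 ≤ prodLaw p x := prodLaw_nonneg hp
  refine ⟨Fin.cons 0 fun i => min (R i.succ) (condEntropy (prodLaw p) (fun x => C.y x i.succ)
    fun x => g i (x i.succ)), rfl, ?_, ?_, fun D hD => ?_, fun i => ?_, fun i => ?_⟩
  · exact Fin.cases le_rfl fun i => le_min (hR.1 i.succ) (condEntropy_nonneg hq _ _)
  · exact Fin.cases (hR.1 0) fun i => min_le_left _ _
  · simp only [sum_eq_add_sum_succ_of_zero_mem hD, Fin.cons_zero, Fin.cons_succ, sub_zero]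
    refine (add_sum_sub_min_le_of_mem_rateRegion hp hR _).trans_eq (condEntropy_congr fun x y => ?_)
    simp only [funext_iff, auxCompl, Subtype.forall, mem_filter_univ, hg', Fin.forall_fin_succ,
      hD, not_true_eq_false, IsEmpty.forall_iff, true_and]
  · rw [condEntropy_unit (sum_prodLaw hp)]
    exact hR.2.2.1 i
  · exact (min_le_right _ _).trans_eq (condEntropy_congr fun x y => hg' i _ _)

end RateSplit

/-! ### Time sharing -/

section TimeSharing

open Filter Topology

variable {κ : Type*} [Fintype κ] {w : κ → ℝ}

/-- The slots of a time-sharing scheme in which the mode `q` is used in proportion to `w q`,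
over about `N` slots. The factor `N + 1` leaves a margin of one slot for strict inequalities. -/
abbrev TimeSlots (w : κ → ℝ) (N : ℕ) : Type _ :=
  Σ q, Fin ⌈w q * (N + 1 : ℝ)⌉₊

theorem nonempty_timeSlots (hw : ∀ q, 0 ≤ w q) (hw1 : ∑ q, w q = 1) (N : ℕ) :
    Nonempty (TimeSlots w N) := by
  obtain ⟨q, -, hq⟩ := exists_ne_zero_of_sum_ne_zero (hw1.trans_ne one_ne_zero)
  exact ⟨⟨q, 0, Nat.ceil_pos.2 (mul_pos ((hw q).lt_of_ne' hq) N.cast_add_one_pos)⟩⟩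

theorem sum_mul_mul_le_sum_timeSlots {H : κ → ℝ} (hH : ∀ q, 0 ≤ H q) (N : ℕ) :
    (∑ q, w q * H q) * (N + 1) ≤ ∑ s : TimeSlots w N, H s.1 := by
  rw [Fintype.sum_sigma, sum_mul]
  refine sum_le_sum fun q _ => ?_
  simp only [sum_const, card_univ, Fintype.card_fin, nsmul_eq_mul]
  rw [mul_right_comm]
  exact mul_le_mul_of_nonneg_right (Nat.le_ceil _) (hH q)

theorem eq_zero_or_lt_sum_timeSlots (hw : ∀ q, 0 ≤ w q) {ρ H : κ → ℝ} (hρ : ∀ q, ρ q ≤ H q)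
    (hH : ∀ q, 0 ≤ H q) {N d : ℕ} (hd : (d : ℝ) ≤ (∑ q, w q * ρ q) * N) :
    d = 0 ∨ (d : ℝ) < ∑ s : TimeSlots w N, H s.1 := by
  rcases le_or_gt (∑ q, w q * ρ q) 0 with h | h
  · have hd0 : (d : ℝ) ≤ 0 := hd.trans (mul_nonpos_of_nonpos_of_nonneg h N.cast_nonneg)
    exact Or.inl (Nat.le_zero.1 (mod_cast hd0))
  · right
    calc (d : ℝ)
      _ ≤ (∑ q, w q * ρ q) * N := hd
      _ < (∑ q, w q * ρ q) * (N + 1) := mul_lt_mul_of_pos_left (lt_add_one _) h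
      _ ≤ (∑ q, w q * H q) * (N + 1) := mul_le_mul_of_nonneg_right
          (sum_le_sum fun q _ => mul_le_mul_of_nonneg_left (hρ q) (hw q)) N.cast_add_one_pos.le
      _ ≤ ∑ s : TimeSlots w N, H s.1 := sum_mul_mul_le_sum_timeSlots hH N

theorem tendsto_card_timeSlots_div (hw : ∀ q, 0 ≤ w q) (hw1 : ∑ q, w q = 1) :
    Tendsto (fun N : ℕ => (Fintype.card (TimeSlots w N) : ℝ) / (N + 1)) atTop (𝓝 1) := by
  have hN : Tendsto (fun N : ℕ => (N : ℝ) + 1) atTop atTop :=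
    tendsto_atTop_add_const_right _ 1 tendsto_natCast_atTop_atTop
  have h := tendsto_finsetSum univ fun q _ => (tendsto_nat_ceil_mul_div_atTop (hw q)).comp hN
  rw [hw1] at h
  refine h.congr fun N => ?_
  simp only [Fintype.card_sigma, Fintype.card_fin, Nat.cast_sum, sum_div, Function.comp_apply]

theorem tendsto_floor_div_card_timeSlots (hw : ∀ q, 0 ≤ w q) (hw1 : ∑ q, w q = 1) {r : ℝ}
    (hr : 0 ≤ r) :
    Tendsto (fun N : ℕ => (⌊r * N⌋₊ : ℝ) / Fintype.card (TimeSlots w N)) atTop (𝓝 r) := by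
  have hfloor : Tendsto (fun N : ℕ => (⌊r * N⌋₊ : ℝ) / N) atTop (𝓝 r) :=
    (tendsto_nat_floor_mul_div_atTop hr).comp tendsto_natCast_atTop_atTop
  have hsucc : Tendsto (fun N : ℕ => (N : ℝ) / (N + 1)) atTop (𝓝 1) :=
    tendsto_natCast_div_add_atTop 1
  have h := (hfloor.mul hsucc).div (tendsto_card_timeSlots_div hw hw1) one_ne_zero
  rw [mul_one, div_one] at h
  refine h.congr' ((eventually_ne_atTop 0).mono fun N hN => ?_)
  rw [Pi.div_apply, div_mul_div_cancel₀ (Nat.cast_ne_zero.2 hN),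
    div_div_div_cancel_right₀ N.cast_add_one_ne_zero]

variable {n : ℕ} {X Y U : Fin (n + 1) → Type*} {V : Type*} [∀ i, Fintype (X i)]
  [∀ i, Fintype (Y i)] [∀ i, Fintype (U i)] {C : Channel X Y V} {g : ∀ i, X i → U i}
  {F : (∀ i, U i) → Y 0} {p : κ → ∀ i, X i → ℝ} {R r : κ → Fin (n + 1) → ℝ}

theorem Channel.achievable_timeSlots (hF : ∀ x, F (fun i => g i (x i)) = C.y x 0)
    (hw : ∀ q, 0 ≤ w q) (hw1 : ∑ q, w q = 1) (hp : ∀ q i, p q i ∈ stdSimplex ℝ (X i))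
    (hR : ∀ q, IsRateSplit C g (p q) (R q) (r q)) (N : ℕ) :
    C.Achievable fun i => ((⌊(∑ q, w q * (R q i - r q i)) * N⌋₊ +
      ⌊(∑ q, w q * r q i) * N⌋₊ : ℕ) : ℝ) / Fintype.card (TimeSlots w N) := by
  have := nonempty_timeSlots hw hw1 N
  have hq (q) : ∀ x, 0 ≤ prodLaw (p q) x := prodLaw_nonneg (hp q)
  have hcloud (i) : (⌊(∑ q, w q * (R q i - r q i)) * N⌋₊ : ℝ) ≤
      (∑ q, w q * (R q i - r q i)) * N :=
    Nat.floor_le <| mul_nonneg (sum_nonneg fun q _ => mul_nonneg (hw q) <|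
      sub_nonneg.2 ((hR q).satellite_le i)) N.cast_nonneg
  have hsatellite (i) : (⌊(∑ q, w q * r q i) * N⌋₊ : ℝ) ≤ (∑ q, w q * r q i) * N :=
    Nat.floor_le <| mul_nonneg (sum_nonneg fun q _ => mul_nonneg (hw q) <|
      (hR q).satellite_nonneg i) N.cast_nonneg
  refine C.achievable_of_lt_sum_condEntropy hF (p := fun s : TimeSlots w N => p s.1)
    (fun s => hp s.1) ?_ (fun D hD => ?_) (fun i => ?_) fun i => ?_
  · simp [(hR _).satellite_zero]
  · refine eq_zero_or_lt_sum_timeSlots hw (fun q => (hR q).sum_cloud_le D hD)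
      (fun q => condEntropy_nonneg (hq q) _ _) ?_
    rw [Nat.cast_sum]
    refine (sum_le_sum fun i _ => hcloud i).trans_eq ?_
    simp only [mul_sum, ← sum_mul, sum_comm (s := D)]
  · refine eq_zero_or_lt_sum_timeSlots hw (fun q => (hR q).rate_le i)
      (fun q => condEntropy_nonneg (hq q) _ _) ?_
    rw [Nat.cast_add]
    refine (add_le_add (hcloud _) (hsatellite _)).trans_eq ?_
    simp only [← add_mul, ← sum_add_distrib, ← mul_add, sub_add_cancel]
  · exact eq_zero_or_lt_sum_timeSlots hw (fun q => (hR q).satellite_le_condEntropy i)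
      (fun q => condEntropy_nonneg (hq q) _ _) (hsatellite _)

theorem Channel.sum_smul_mem_capacityRegion (hF : ∀ x, F (fun i => g i (x i)) = C.y x 0)
    (hw : ∀ q, 0 ≤ w q) (hw1 : ∑ q, w q = 1) (hp : ∀ q i, p q i ∈ stdSimplex ℝ (X i))
    (hR : ∀ q, IsRateSplit C g (p q) (R q) (r q)) :
    ∑ q, w q • R q ∈ C.capacityRegion := by
  refine mem_closure_of_tendsto (b := atTop) (tendsto_pi_nhds.2 fun i => ?_)
    (Eventually.of_forall (achievable_timeSlots hF hw hw1 hp hR))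
  have hlim : (∑ q, w q • R q) i = ∑ q, w q * (R q i - r q i) + ∑ q, w q * r q i := by
    simp [← sum_add_distrib, ← mul_add]
  rw [hlim]
  simp only [Nat.cast_add, add_div]
  exact (tendsto_floor_div_card_timeSlots hw hw1 <| sum_nonneg fun q _ =>
      mul_nonneg (hw q) (sub_nonneg.2 ((hR q).satellite_le i))).add
    (tendsto_floor_div_card_timeSlots hw hw1 <| sum_nonneg fun q _ =>
      mul_nonneg (hw q) ((hR q).satellite_nonneg i))

end TimeSharing

theorem exists_fiber_representative {α β : Type*} (g : α → β) :
    ∃ r : α → α, (∀ x, g (r x) = g x) ∧ ∀ x y, g x = g y ↔ r x = r y :=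
  ⟨fun x => Set.rangeSplitting g (Set.rangeFactorization g x),
    fun x => Set.apply_rangeSplitting g _,
    fun x y => by
      rw [(Set.rangeSplitting_injective g).eq_iff, Subtype.ext_iff, Set.rangeFactorization_coe,
        Set.rangeFactorization_coe]⟩

theorem Channel.y_zero_congr {n : ℕ} {X Y : Fin (n + 1) → Type*} {V : Type*}
    (C : Channel X Y V) {x x' : ∀ i, X i} (h0 : x 0 = x' 0) (hv : C.v x = C.v x') :
    C.y x 0 = C.y x' 0 :=
  congrArg₂ C.f₁ h0 hv

end ManyToOne

theorem theorem2 {n : ℕ} {X Y : Fin (n + 1) → Type*} {V : Type*} {U : Fin n → Type*}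
    [∀ i, Fintype (X i)] [∀ i, Fintype (Y i)] [Fintype V] [∀ i, Fintype (U i)]
    (C : ManyToOne.Channel X Y V)
    (g : ∀ i : Fin n, X i.succ → U i)
    (hV : ∃ h : (∀ i, U i) → V, ∀ x : ∀ i : Fin n, X i.succ,
      C.interf x = h fun i => g i (x i)) :
    convexHull ℝ (⋃ p ∈ {p : ∀ i, X i → ℝ | ∀ i, p i ∈ stdSimplex ℝ (X i)}, C.rateRegion g p) ⊆
      C.capacityRegion := by
  intro R hR
  obtain ⟨κ, _, w, z, hw, hw1, hz, rfl⟩ := mem_convexHull_iff_exists_fintype.1 hR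
  simp only [Set.mem_iUnion, Set.mem_ofPred_eq, exists_prop] at hz
  choose p hp hz using hz
  obtain ⟨h, hh⟩ := hV
  choose r hgr hr using fun i => ManyToOne.exists_fiber_representative (g i)
  let g' : ∀ i, X i → X i := Fin.cons id r
  have hg' (x : ∀ i, X i) : C.y (fun i => g' i (x i)) 0 = C.y x 0 := by
    refine C.y_zero_congr rfl ?_
    simp only [ManyToOne.Channel.v, hh, g', Fin.cons_succ, hgr]
  choose s hs using fun q =>
    ManyToOne.Channel.exists_isRateSplit_of_mem_rateRegion (hp q) (hz q) (g' := g') hr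
  exact ManyToOne.Channel.sum_smul_mem_capacityRegion (F := fun x => C.y x 0) hg' hw hw1 hp hs
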